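/- For a real number $x$ let $\|x\|$ denote the distance of $x$ to the nearest integer. There are absolute constants $C_1,C_2>0$ and, for every $\varepsilon>0$, a constant $c(\varepsilon)>0$ depending only on $\varepsilon$, such that the following holds. Let $\alpha$ be an irrational real number, and let $q>1$ and $a$ be integers with $$(2a,q)=1\quad\text{and}\quad \left|\alpha-\frac aq\right|<\frac{24}{q^2}.$$ Let $1/3+6\varepsilon<\beta<1$ and put $X:=q^{1+\beta}$ and $\gamma:=(1-\beta)/(1+\beta)$. Then $$\#\{n\in\mathbb{N}:\ 1\le n\le 2X,\ n=x^2+y^2 \text{ for some } x,y\in\mathbb{Z},\ \|n\alpha\|<C_1n^{-\gamma}\}\ \ge\ c(\varepsilon)\,X^{1-\gamma-C_2/\log\log X}.$$ Moreover, for every irrational $\alpha$ there are infinitely many rational numbers $a/q$ satisfying the above conditions. In particular, for every irrational $\alpha$, every $0<\varepsilon<1/2$ and every $\delta>0$ there are infinitely many $N\in\mathbb{N}$ such that $$\#\{n\in\mathbb{N}:\ 1\le n\le N,\ n=x^2+y^2 \text{ for some } x,y\in\mathbb{Z},\ \|n\alpha\|<n^{-(1/2-\varepsilon)}\}\ \ge\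 N^{1/2+\varepsilon-\delta}.$$ -/

import Mathlib

/-- The distance `‖x‖` of a real number `x` to the nearest integer. -/
noncomputable def distNearestInt (x : ℝ) : ℝ := |x - (round x : ℝ)|

/-- The positive integers `n ≤ N` which are sums of two squares of integers and satisfy
`‖n α‖ < C n ^ (-γ)`. -/
def twoSquaresApprox (α C γ N : ℝ) : Set ℕ :=
  {n : ℕ | 0 < n ∧ (n : ℝ) ≤ N ∧ (∃ x y : ℤ, (n : ℤ) = x ^ 2 + y ^ 2) ∧
    distNearestInt ((n : ℝ) * α) < C * (n : ℝ) ^ (-γ)}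

/-- The conditions on the approximating fraction `a / q`: `(2a, q) = 1` and
`|α - a / q| < 24 / q ^ 2`. The denominator is taken larger than `1` (hence at least `3`), so that
`log log X` is defined for `X = q ^ (1 + β)`. -/
def IsAdmissibleFraction (α : ℝ) (a : ℤ) (q : ℕ) : Prop :=
  1 < q ∧ Int.gcd (2 * a) (q : ℤ) = 1 ∧ |α - (a : ℝ) / (q : ℝ)| < 24 / (q : ℝ) ^ 2

/-! Suppose `n ≤ 2X = 2 q^(1+β)` and `a n` is congruent mod `q` to an integer of size at most `q^β`.
Replacing `α` by `a/q` changes `n α` by at most `24 n / q²`, so `‖n α‖` is `O(q^(β-1)) = O(X^(-γ))`.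
It remains to find many such `n = x² + y²`.

Count pairs in a box of side `Y ≈ X^(1/2)` with `a (x² + y²) ≡ r - s`, where `r, s < R ≈ q^β`.
Counting triples with `r` and `s` separate makes the Fourier weight `|linSum|²`. The zero frequency
gives `Y² R²`. At `h ≠ 0`, Weyl differencing (`norm_quadSum_sq_le`) bounds the squared quadratic sum
by `Y` plus a sum over `d` of `min (Y, q / |2ahd|)`. Grouping by `m = h d` costs a divisor factor
`T`, and since `2a` is a unit, `2am` equidistributes over blocks of `q` consecutive `m`
(`error_sum_le`). The error is `R Y q T` up to logarithms, so the main term wins once `R Y ≈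
q^((1+3β)/2)` beats `q^(1+9ε)`: this is `β > 1/3 + 6ε`.

Thus there are at least about `Y² R / q ≈ q^(2β) = X^(1-γ)` good pairs. Each `n` comes from at most
`τ(n)²` of them (`card_repr_le`), which costs only `X^(O(1 / log log X))` by `card_divisors_le_exp`.

Admissible fractions come from Dirichlet approximation, an even denominator being traded for a
neighbouring odd one. For the last assertion, a `γ` slightly above `1/2 - ε` absorbs the constant
`C₁`. -/

section ExponentialSums

/-! ### Geometric sums and Weyl differencing modulo `q`. -/

open Finset ZMod

/-- The absolute value of the least absolute residue of `z`. -/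
def absResidue {q : ℕ} (z : ZMod q) : ℕ := z.valMinAbs.natAbs

/-- The majorant `min (L, q / |z|)` of a geometric sum of length `L` modulo `q`. -/
noncomputable def geomBound {q : ℕ} (L : ℕ) (z : ZMod q) : ℝ :=
  if z = 0 then (L : ℝ) else min (L : ℝ) ((q : ℝ) / absResidue z)

section
variable {q : ℕ}

theorem absResidue_pos {z : ZMod q} (hz : z ≠ 0) : 0 < absResidue z := by
  simpa [absResidue, Int.natAbs_pos, ZMod.valMinAbs_eq_zero] using hz

theorem geomBound_nonneg (L : ℕ) (z : ZMod q) : 0 ≤ geomBound L z := by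
  unfold geomBound; split_ifs <;> positivity

theorem geomBound_mono {L M : ℕ} (h : L ≤ M) (z : ZMod q) : geomBound L z ≤ geomBound M z := by
  have : (L : ℝ) ≤ M := by exact_mod_cast h
  unfold geomBound; split_ifs
  · exact this
  · exact min_le_min_right _ this

theorem geomBound_le (L : ℕ) (z : ZMod q) : geomBound L z ≤ L := by
  unfold geomBound; split_ifs
  · exact le_rfl
  · exact min_le_left _ _

variable [NeZero q]

theorem absResidue_eq_min (z : ZMod q) : absResidue z = min z.val (q - z.val) :=
  ZMod.valMinAbs_natAbs_eq_min z

/-- The left-out quantity is `2 |sin (π z / q)|`; Jordan's inequality bounds the sine below. -/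
theorem norm_stdAddChar_sub_one_ge (z : ZMod q) :
    4 * (absResidue z : ℝ) / q ≤ ‖stdAddChar z - 1‖ := by
  have hq : (0 : ℝ) < q := by exact_mod_cast NeZero.pos q
  have h1 : stdAddChar z = Complex.exp (Complex.I * ((2 * Real.pi * z.valMinAbs / q : ℝ) : ℂ)) := by
    conv_lhs => rw [← ZMod.coe_valMinAbs z]
    rw [ZMod.stdAddChar_coe]
    congr 1; push_cast; ring
  rw [h1, Complex.norm_exp_I_mul_ofReal_sub_one]
  have h2 : (2 * absResidue z : ℝ) ≤ q := by
    have := ZMod.natAbs_valMinAbs_le z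
    have h3 : 2 * absResidue z ≤ q := by unfold absResidue; omega
    exact_mod_cast h3
  have h3 : |(z.valMinAbs : ℝ)| = absResidue z := by
    unfold absResidue; rw [Nat.cast_natAbs]; simp
  have h4 : |Real.pi * z.valMinAbs / q| ≤ Real.pi / 2 := by
    rw [abs_div, abs_mul, h3, abs_of_pos Real.pi_pos, abs_of_pos hq, div_le_iff₀ hq]
    nlinarith [Real.pi_pos]
  have h5 := Real.mul_abs_le_abs_sin h4
  rw [norm_mul, Real.norm_eq_abs, Real.norm_eq_abs, abs_of_pos (by norm_num : (0:ℝ) < 2)]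
  rw [show 2 * Real.pi * z.valMinAbs / q / 2 = Real.pi * z.valMinAbs / q by ring]
  rw [abs_div, abs_mul, h3, abs_of_pos Real.pi_pos, abs_of_pos hq] at h5
  calc 4 * (absResidue z : ℝ) / q = 2 * (2 / Real.pi * (Real.pi * absResidue z / q)) := by
        field_simp; ring
    _ ≤ _ := by linarith

theorem norm_stdAddChar (z : ZMod q) : ‖stdAddChar z‖ = 1 := by
  rw [ZMod.stdAddChar_apply]; exact Circle.norm_coe _

theorem norm_sum_stdAddChar_le (L : ℕ) (z : ZMod q) :
    ‖∑ j ∈ range L, stdAddChar (z * (j : ZMod q))‖ ≤ geomBound L z := by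
  have hL : ‖∑ j ∈ range L, stdAddChar (z * (j : ZMod q))‖ ≤ L := by
    refine (norm_sum_le _ _).trans ?_
    simp
  unfold geomBound; split_ifs with hz
  · exact hL
  refine le_min hL ?_
  have hq : (0 : ℝ) < q := by exact_mod_cast NeZero.pos q
  have hr : (0 : ℝ) < absResidue z := by exact_mod_cast absResidue_pos hz
  have h1 := norm_stdAddChar_sub_one_ge z
  have hpos : 0 < ‖stdAddChar z - 1‖ := lt_of_lt_of_le (by positivity) h1
  have hne : stdAddChar z ≠ 1 := fun h => by simp [h] at hpos
  have h2 : ∑ j ∈ range L, stdAddChar (z * (j : ZMod q)) =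
      (stdAddChar z ^ L - 1) / (stdAddChar z - 1) := by
    rw [← geom_sum_eq hne]
    refine sum_congr rfl fun j _ => ?_
    rw [← AddChar.map_nsmul_eq_pow, nsmul_eq_mul, mul_comm]
  rw [h2, norm_div, div_le_div_iff₀ hpos hr]
  have h3 : ‖stdAddChar z ^ L - 1‖ ≤ 2 := by
    refine (norm_sub_le _ _).trans ?_
    rw [norm_pow, norm_stdAddChar]; norm_num
  rw [div_le_iff₀ hq] at h1
  nlinarith

theorem sum_absResidue_le (f : ℕ → ℝ) (hf : ∀ n, 0 ≤ f n) :
    ∑ z ∈ (univ : Finset (ZMod q)).erase 0, f (absResidue z) ≤ 2 * ∑ h ∈ Ico 1 q, f h := by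
  have h1 : ∀ z ∈ (univ : Finset (ZMod q)).erase 0,
      f (absResidue z) ≤ f z.val + f (q - z.val) := by
    intro z _
    rw [absResidue_eq_min]
    rcases min_choice z.val (q - z.val) with h | h <;> rw [h]
    · linarith [hf (q - z.val)]
    · linarith [hf z.val]
  refine (sum_le_sum h1).trans ?_
  rw [sum_add_distrib, two_mul]
  have hpos : ∀ z ∈ (univ : Finset (ZMod q)).erase 0, 1 ≤ z.val := by
    intro z hz
    exact Nat.one_le_iff_ne_zero.2 (by simpa using hz)
  refine add_le_add ?_ ?_
  · rw [← sum_image (f := f) (g := fun z : ZMod q => z.val)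
      (fun x _ y _ h => ZMod.val_injective q h)]
    refine sum_le_sum_of_subset_of_nonneg ?_ fun _ _ _ => hf _
    intro n hn
    obtain ⟨z, hz, rfl⟩ := mem_image.1 hn
    exact mem_Ico.2 ⟨hpos z hz, ZMod.val_lt z⟩
  · rw [← sum_image (f := f) (g := fun z : ZMod q => q - z.val)
      (fun x _ y _ h => ZMod.val_injective q (by
        have := ZMod.val_lt x; have := ZMod.val_lt y; simp only at h; omega))]
    refine sum_le_sum_of_subset_of_nonneg ?_ fun _ _ _ => hf _
    intro n hn
    obtain ⟨z, hz, rfl⟩ := mem_image.1 hn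
    have := ZMod.val_lt z
    have := hpos z hz
    exact mem_Ico.2 ⟨by omega, by omega⟩

theorem sum_Ico_inv_le (n : ℕ) : ∑ h ∈ Ico 1 n, (1 / (h : ℝ)) ≤ 1 + Real.log n := by
  have h := harmonic_le_one_add_log n
  refine le_trans ?_ h
  rw [harmonic_eq_sum_Icc]
  push_cast
  simp_rw [one_div]
  exact sum_le_sum_of_subset_of_nonneg Ico_subset_Icc_self fun _ _ _ => by positivity

theorem sum_geomBound_le (L : ℕ) :
    ∑ z : ZMod q, geomBound L z ≤ L + 2 * (q * (1 + Real.log q)) := by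
  rw [← add_sum_erase _ _ (mem_univ (0 : ZMod q))]
  refine add_le_add (geomBound_le _ _) ?_
  calc ∑ z ∈ (univ : Finset (ZMod q)).erase 0, geomBound L z
      ≤ ∑ z ∈ (univ : Finset (ZMod q)).erase 0, (fun n : ℕ => (q : ℝ) * (1 / n)) (absResidue z) := by
        refine sum_le_sum fun z hz => ?_
        rw [geomBound, if_neg (by simpa using hz)]
        refine (min_le_right _ _).trans (le_of_eq ?_)
        simp [div_eq_mul_inv]
    _ ≤ 2 * ∑ h ∈ Ico 1 q, (q : ℝ) * (1 / h) := 
        sum_absResidue_le (fun n : ℕ => (q : ℝ) * (1 / n)) fun n => by positivity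
    _ ≤ _ := by
        rw [← mul_sum]
        gcongr
        exact sum_Ico_inv_le q

/-- Substitution `d = x - y`, used to collect off-diagonal terms by difference. -/
theorem sum_lt_eq_sum_shift {M : Type*} [AddCommMonoid M] (Y : ℕ) (G : ℕ → ℕ → M) :
    ∑ x ∈ range Y, ∑ y ∈ range x, G x y = ∑ d ∈ Ico 1 Y, ∑ y ∈ range (Y - d), G (y + d) y := by
  rw [sum_sigma', sum_sigma']
  refine sum_bij' (fun p _ => ⟨p.1 - p.2, p.2⟩) (fun p _ => ⟨p.2 + p.1, p.2⟩) ?_ ?_ ?_ ?_ ?_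
  · rintro ⟨x, y⟩ h; simp at h ⊢; omega
  · rintro ⟨x, y⟩ h; simp at h ⊢; omega
  · rintro ⟨x, y⟩ h; simp at h ⊢; omega
  · rintro ⟨x, y⟩ h; simp at h ⊢
  · rintro ⟨x, y⟩ h; simp at h ⊢
    rw [Nat.add_sub_cancel' h.2.le]

/-- Expanding the square, the diagonal gives `Y`, and the terms with `x < y` are conjugate to those
with `x > y`. -/
theorem norm_sum_sq_le (Y : ℕ) (f : ℕ → ℂ) (hf : ∀ n, ‖f n‖ = 1) :
    ‖∑ x ∈ range Y, f x‖ ^ 2 ≤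
      Y + 2 * ∑ d ∈ Ico 1 Y, ‖∑ y ∈ range (Y - d), f (y + d) * starRingEnd ℂ (f y)‖ := by
  have key : ∀ Z : ℕ, ‖∑ x ∈ range Z, f x‖ ^ 2 =
      Z + 2 * (∑ x ∈ range Z, ∑ y ∈ range x, f x * starRingEnd ℂ (f y)).re := by
    intro Z
    induction Z with
    | zero => simp
    | succ Z ih =>
      rw [sum_range_succ, sum_range_succ, Complex.add_re, ← mul_sum, ← map_sum]
      rw [← Complex.normSq_eq_norm_sq, Complex.normSq_add, Complex.normSq_eq_norm_sq,
        Complex.normSq_eq_norm_sq, ih, hf]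
      have : ((∑ x ∈ range Z, f x) * (starRingEnd ℂ) (f Z)).re =
          (f Z * (starRingEnd ℂ) (∑ x ∈ range Z, f x)).re := by
        rw [← Complex.conj_re (f Z * _)]
        simp [mul_comm]
      rw [this]; push_cast; ring
  rw [key, sum_lt_eq_sum_shift]
  gcongr
  exact (Complex.re_le_norm _).trans (norm_sum_le _ _)

/-- The quadratic exponential sum `∑_{1 ≤ x ≤ Y} e(u x² / q)`. -/
noncomputable def quadSum (Y : ℕ) (u : ZMod q) : ℂ :=
  ∑ x ∈ range Y, stdAddChar (u * ((x : ZMod q) + 1) ^ 2)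

theorem conj_stdAddChar (z : ZMod q) : starRingEnd ℂ (stdAddChar z) = stdAddChar (-z) := by
  rw [AddChar.map_neg_eq_conj]

/-- Weyl differencing: a difference of two squares at distance `d` is linear in `y` with frequency
`2ud`, leaving a geometric sum. -/
theorem norm_quadSum_sq_le (Y : ℕ) (u : ZMod q) :
    ‖quadSum Y u‖ ^ 2 ≤ Y + 2 * ∑ d ∈ Ico 1 Y, geomBound Y (2 * u * (d : ZMod q)) := by
  refine (norm_sum_sq_le Y _ fun _ => norm_stdAddChar _).trans ?_
  gcongr with d hd
  have : ∀ y : ℕ, stdAddChar (u * (((y + d : ℕ) : ZMod q) + 1) ^ 2) *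
      starRingEnd ℂ (stdAddChar (u * ((y : ZMod q) + 1) ^ 2)) =
      stdAddChar (u * (2 * (d : ZMod q) + (d : ZMod q) ^ 2)) *
        stdAddChar (2 * u * (d : ZMod q) * (y : ZMod q)) := by
    intro y
    rw [conj_stdAddChar, ← AddChar.map_add_eq_mul, ← AddChar.map_add_eq_mul]
    congr 1; push_cast; ring
  simp_rw [this]
  rw [← mul_sum, norm_mul, norm_stdAddChar, one_mul]
  exact (norm_sum_stdAddChar_le _ _).trans (geomBound_mono (Nat.sub_le _ _) _)

theorem norm_quadSum_neg (Y : ℕ) (u : ZMod q) : ‖quadSum Y (-u)‖ = ‖quadSum Y u‖ := by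
  rw [← Complex.norm_conj (quadSum Y u)]
  unfold quadSum
  rw [map_sum]
  simp_rw [conj_stdAddChar, neg_mul]

theorem norm_quadSum_absResidue (Y : ℕ) (a h : ZMod q) :
    ‖quadSum Y (a * h)‖ = ‖quadSum Y (a * ((absResidue h : ℕ) : ZMod q))‖ := by
  unfold absResidue
  rw [ZMod.natCast_natAbs_valMinAbs]
  split_ifs
  · rfl
  · rw [mul_neg, norm_quadSum_neg]

end

end ExponentialSums

/-! ### Fourier count of the good pairs and its error term. -/

section GoodPairs

open Finset ZMod

section
variable {q : ℕ}

/-- The linear exponential sum `∑_{0 ≤ r < R} e(h r / q)`. -/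
noncomputable def linSum [NeZero q] (R : ℕ) (h : ZMod q) : ℂ := ∑ r ∈ range R, stdAddChar (h * (r : ZMod q))

/-- The pairs `(x, y)` of `range Y` for which `a ((x + 1)² + (y + 1)²)` is congruent to
some `r - s` with `r, s < R`. -/
def goodPairs (a : ZMod q) (Y R : ℕ) : Finset (ℕ × ℕ) :=
  {p ∈ range Y ×ˢ range Y | ∃ r ∈ range R, ∃ s ∈ range R,
    a * (((p.1 : ZMod q) + 1) ^ 2 + ((p.2 : ZMod q) + 1) ^ 2) + s - r = 0}

/-- Since `R ≤ q`, a pair and `r` determine `s`, so a good pair is counted at most `R` times. -/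
theorem count_le_card_goodPairs (a : ZMod q) (Y : ℕ) {R : ℕ} (hR : R ≤ q) :
    (∑ p ∈ range Y ×ˢ range Y, ∑ r ∈ range R, ∑ s ∈ range R,
        if a * (((p.1 : ZMod q) + 1) ^ 2 + ((p.2 : ZMod q) + 1) ^ 2) + s - r = 0
          then 1 else 0) ≤ R * #(goodPairs a Y R) := by
  unfold goodPairs
  rw [card_filter, mul_sum]
  refine sum_le_sum fun p _ => ?_
  split_ifs with hp
  · calc _ ≤ ∑ r ∈ range R, 1 := by
          refine sum_le_sum fun r _ => ?_
          rw [← card_filter, card_le_one]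
          intro s hs t ht
          rw [mem_filter, mem_range] at hs ht
          have h := hs.2.trans ht.2.symm
          have h2 : (s : ZMod q) = t := by
            have := sub_left_injective h
            simpa using this
          rw [ZMod.natCast_eq_natCast_iff'] at h2
          rwa [Nat.mod_eq_of_lt (by omega), Nat.mod_eq_of_lt (by omega)] at h2
      _ = _ := by simp
  · simp only [mul_zero, nonpos_iff_eq_zero]
    refine sum_eq_zero fun r hr => sum_eq_zero fun s hs => if_neg fun h => hp ⟨r, hr, s, hs, h⟩

variable [NeZero q]

theorem conj_linSum (R : ℕ) (h : ZMod q) : starRingEnd ℂ (linSum R h) = linSum R (-h) := by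
  unfold linSum
  rw [map_sum]
  simp_rw [conj_stdAddChar, neg_mul]

theorem sum_char_eq_count (a : ZMod q) (Y R : ℕ) :
    ∑ h : ZMod q, quadSum Y (a * h) ^ 2 * (linSum R h * linSum R (-h)) =
      q * ∑ p ∈ range Y ×ˢ range Y, ∑ r ∈ range R, ∑ s ∈ range R,
        if a * (((p.1 : ZMod q) + 1) ^ 2 + ((p.2 : ZMod q) + 1) ^ 2) + s - r = 0
          then (1 : ℂ) else 0 := by
  have h1 : ∀ h : ZMod q, quadSum Y (a * h) ^ 2 * (linSum R h * linSum R (-h)) =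
      ∑ p ∈ range Y ×ˢ range Y, ∑ r ∈ range R, ∑ s ∈ range R,
        stdAddChar (h * (a * (((p.1 : ZMod q) + 1) ^ 2 + ((p.2 : ZMod q) + 1) ^ 2) +
          (s : ZMod q) - (r : ZMod q))) := by
    intro h
    unfold quadSum linSum
    rw [pow_two, sum_mul_sum, ← sum_product', mul_comm (∑ r ∈ range R, _) (∑ r ∈ range R, _),
      sum_mul_sum, sum_mul]
    refine sum_congr rfl fun p _ => ?_
    rw [mul_sum]
    refine sum_congr rfl fun r _ => ?_
    rw [mul_sum]
    refine sum_congr rfl fun s _ => ?_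
    simp only [← AddChar.map_add_eq_mul]
    congr 1; ring
  simp_rw [h1]
  rw [sum_comm, mul_sum]
  refine sum_congr rfl fun p _ => ?_
  rw [sum_comm, mul_sum]
  refine sum_congr rfl fun r _ => ?_
  rw [sum_comm, mul_sum]
  refine sum_congr rfl fun s _ => ?_
  rw [AddChar.sum_mulShift _ (ZMod.isPrimitive_stdAddChar q), ZMod.card]
  split_ifs <;> simp

/-- Orthogonality of characters, with the frequency `h = 0` isolated on the left. -/
theorem main_term_le (a : ZMod q) (Y : ℕ) {R : ℕ} (hR : R ≤ q) :
    (Y : ℝ) ^ 2 * R ^ 2 ≤ q * (R * #(goodPairs a Y R)) +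
      ∑ h ∈ (univ : Finset (ZMod q)).erase 0, ‖quadSum Y (a * h)‖ ^ 2 * ‖linSum R h‖ ^ 2 := by
  have h1 := sum_char_eq_count a Y R
  rw [← add_sum_erase _ _ (mem_univ (0 : ZMod q))] at h1
  have h0 : quadSum Y (a * 0) ^ 2 * (linSum R (0 : ZMod q) * linSum R (-0 : ZMod q)) =
      (Y : ℂ) ^ 2 * R ^ 2 := by
    simp [quadSum, linSum, pow_two]
  rw [h0] at h1
  have h2 := count_le_card_goodPairs a Y hR
  set N : ℕ := ∑ p ∈ range Y ×ˢ range Y, ∑ r ∈ range R, ∑ s ∈ range R,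
        if a * (((p.1 : ZMod q) + 1) ^ 2 + ((p.2 : ZMod q) + 1) ^ 2) + s - r = 0
          then 1 else 0 with hN
  have h3 : (Y : ℂ) ^ 2 * R ^ 2 = q * N - ∑ h ∈ (univ : Finset (ZMod q)).erase 0,
      quadSum Y (a * h) ^ 2 * (linSum R h * linSum R (-h)) := by
    rw [eq_sub_iff_add_eq, h1, hN]
    push_cast
    rfl
  have h4 : (Y : ℝ) ^ 2 * R ^ 2 = ‖(Y : ℂ) ^ 2 * R ^ 2‖ := by simp
  rw [h4, h3]
  refine (norm_sub_le _ _).trans (add_le_add ?_ ((norm_sum_le _ _).trans (sum_le_sum ?_)))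
  · rw [norm_mul, Complex.norm_natCast, Complex.norm_natCast]
    gcongr
    exact_mod_cast h2
  · intro h _
    rw [← conj_linSum, norm_mul, norm_mul, norm_pow, Complex.norm_conj, pow_two ‖linSum R h‖]

theorem norm_linSum_sq_le (R : ℕ) {h : ZMod q} (hh : h ≠ 0) :
    ‖linSum R h‖ ^ 2 ≤ min (R : ℝ) (q / absResidue h) ^ 2 := by
  have := norm_sum_stdAddChar_le R h
  rw [geomBound, if_neg hh] at this
  unfold linSum
  gcongr

theorem error_term_le (a : ZMod q) (Y R : ℕ) :
    ∑ h ∈ (univ : Finset (ZMod q)).erase 0, ‖quadSum Y (a * h)‖ ^ 2 * ‖linSum R h‖ ^ 2 ≤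
      2 * ∑ h ∈ Ico 1 q, (Y + 2 * ∑ d ∈ Ico 1 Y, geomBound Y (2 * a * ((h * d : ℕ) : ZMod q))) *
        min (R : ℝ) (q / h) ^ 2 := by
  refine le_trans (sum_le_sum fun h hh => ?_) (sum_absResidue_le (q := q) (fun n =>
    (Y + 2 * ∑ d ∈ Ico 1 Y, geomBound Y (2 * a * ((n * d : ℕ) : ZMod q))) *
        min (R : ℝ) (q / n) ^ 2) fun n => ?_)
  · rw [norm_quadSum_absResidue]
    have h1 := norm_quadSum_sq_le Y (a * ((absResidue h : ℕ) : ZMod q))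
    have h2 := norm_linSum_sq_le R (show h ≠ 0 by simpa using hh)
    refine mul_le_mul (h1.trans (le_of_eq ?_)) h2 (by positivity) ?_
    · congr 2
      refine sum_congr rfl fun d _ => ?_
      congr 1; push_cast; ring
    · exact add_nonneg (by positivity)
        (mul_nonneg (by norm_num) (sum_nonneg fun _ _ => geomBound_nonneg _ _))
  · exact mul_nonneg (add_nonneg (by positivity)
        (mul_nonneg (by norm_num) (sum_nonneg fun _ _ => geomBound_nonneg _ _))) (by positivity)

/-- A product `m = h d` arises from at most `τ(m)` pairs, as `h` divides `m` and determines `d`. -/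
theorem sum_mul_le_sum_of_card_divisors_le (F : ℕ → ℝ) (hF : ∀ n, 0 ≤ F n) (A B : ℕ) {T : ℝ}
    (hT : ∀ n, 0 < n → n < A * B → (#n.divisors : ℝ) ≤ T) :
    ∑ h ∈ Ico 1 A, ∑ d ∈ Ico 1 B, F (h * d) ≤ T * ∑ m ∈ Ico 1 (A * B), F m := by
  rw [← sum_product', mul_sum]
  have hmaps : ∀ p ∈ Ico 1 A ×ˢ Ico 1 B, p.1 * p.2 ∈ Ico 1 (A * B) := by
    rintro ⟨x, y⟩ hp
    simp only [mem_product, mem_Ico] at hp ⊢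
    exact ⟨Nat.mul_pos (by omega) (by omega), Nat.mul_lt_mul'' hp.1.2 hp.2.2⟩
  rw [← sum_fiberwise_of_maps_to hmaps]
  refine sum_le_sum fun m hm => ?_
  rw [mem_Ico] at hm
  rw [sum_congr rfl (g := fun _ => F m) (fun p hp => by rw [(mem_filter.1 hp).2]), sum_const,
    nsmul_eq_mul]
  refine mul_le_mul_of_nonneg_right (le_trans ?_ (hT m hm.1 hm.2)) (hF m)
  refine Nat.cast_le.2 (card_le_card_of_injOn (fun p => p.1) ?_ ?_)
  · intro p hp
    have := (mem_filter.1 hp).2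
    exact Nat.mem_divisors.2 ⟨⟨p.2, this.symm⟩, by omega⟩
  · intro p hp r hr h
    have hp := mem_filter.1 hp
    have hr := mem_filter.1 hr
    simp only at h
    have h1 : 0 < p.1 := by have := hp.1; simp at this; omega
    refine Prod.ext h (Nat.eq_of_mul_eq_mul_left h1 ?_)
    rw [hp.2, h, hr.2]

theorem sum_range_mul_eq (F : ℕ → ℝ) (A B : ℕ) :
    ∑ m ∈ range (A * B), F m = ∑ i ∈ range B, ∑ j ∈ range A, F (A * i + j) := by
  induction B with
  | zero => simp
  | succ B ih => rw [Nat.mul_succ, sum_range_add, ih, sum_range_succ]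

theorem sum_block_eq (G : ZMod q → ℝ) {u : ZMod q} (hu : IsUnit u) (i : ℕ) :
    ∑ j ∈ range q, G (u * ((q * i + j : ℕ) : ZMod q)) = ∑ z : ZMod q, G z := by
  have h1 : ∑ j ∈ range q, G (u * ((q * i + j : ℕ) : ZMod q)) = ∑ z : ZMod q, G (u * z) := by
    refine sum_bij' (fun j _ => (j : ZMod q)) (fun z _ => z.val) (by simp) ?_ ?_ ?_ ?_
    · intro z _; exact mem_range.2 (ZMod.val_lt z)
    · intro j hj; exact ZMod.val_cast_of_lt (mem_range.1 hj)
    · intro z _; exact ZMod.natCast_zmod_val z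
    · intro j _; simp
  rw [h1]
  obtain ⟨v, rfl⟩ := hu
  exact Equiv.sum_comp (Units.mulLeft v) G

/-- Cut the range into `Y` blocks of length `q`. On block `i` the weight is at most `Y / i` (or `R`
if `i = 0`), and multiplication by the unit `u` makes each block a complete residue system. -/
theorem sum_weighted_geomBound_le {u : ZMod q} (hu : IsUnit u) (Y R : ℕ) :
    ∑ m ∈ Ico 1 (q * Y), min (R : ℝ) (q * Y / m) * geomBound Y (u * (m : ZMod q)) ≤
      (R + Y * (1 + Real.log Y)) * (Y + 2 * (q * (1 + Real.log q))) := by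
  have hq : (0 : ℝ) < q := by exact_mod_cast NeZero.pos q
  have hG := sum_geomBound_le (q := q) Y
  have hG0 : 0 ≤ ∑ z : ZMod q, geomBound Y z := sum_nonneg fun _ _ => geomBound_nonneg _ _
  rcases Nat.eq_zero_or_pos Y with rfl | hY
  · simp; positivity
  set c : ℕ → ℝ := fun i => if i = 0 then (R : ℝ) else Y * (1 / i) with hc
  have hc0 : ∀ i, 0 ≤ c i := fun i => by simp only [hc]; split_ifs <;> positivity
  calc _ ≤ ∑ m ∈ range (q * Y), min (R : ℝ) (if m = 0 then R else q * Y / m) *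
          geomBound Y (u * (m : ZMod q)) := by
        rw [range_eq_Ico]
        refine le_trans (le_of_eq (sum_congr rfl fun m hm => ?_)) (sum_le_sum_of_subset_of_nonneg
          (Ico_subset_Ico_left zero_le_one) fun m _ _ => ?_)
        · rw [if_neg (by have := mem_Ico.1 hm; omega)]
        · refine mul_nonneg (le_min (by positivity) ?_) (geomBound_nonneg _ _)
          split_ifs <;> positivity
    _ ≤ ∑ i ∈ range Y, c i * ∑ z : ZMod q, geomBound Y z := by
        rw [sum_range_mul_eq]
        refine sum_le_sum fun i _ => ?_
        rw [← sum_block_eq _ hu i, mul_sum]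
        refine sum_le_sum fun j _ => ?_
        refine mul_le_mul_of_nonneg_right ?_ (geomBound_nonneg _ _)
        simp only [hc]
        by_cases hi : i = 0
        · rw [if_pos hi]; exact min_le_left _ _
        · rw [if_neg hi]
          refine (min_le_right _ _).trans ?_
          have hi' : 0 < i := Nat.pos_of_ne_zero hi
          have hqi : 0 < q * i := Nat.mul_pos (NeZero.pos q) hi'
          rw [if_neg (by omega)]
          have : (0 : ℝ) < i := by exact_mod_cast hi'
          calc (q : ℝ) * Y / ((q * i + j : ℕ) : ℝ) ≤ q * Y / (q * i) := by
                gcongr; push_cast; linarith [(Nat.cast_nonneg j : (0:ℝ) ≤ j)]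
            _ = _ := by field_simp
    _ ≤ _ := by
        rw [← sum_mul]
        refine mul_le_mul ?_ hG hG0 ?_
        · rw [range_eq_Ico, sum_eq_sum_Ico_succ_bot hY]
          refine add_le_add (by simp [hc]) ?_
          calc ∑ i ∈ Ico 1 Y, c i = Y * ∑ i ∈ Ico 1 Y, (1 / (i : ℝ)) := by
                rw [mul_sum]
                refine sum_congr rfl fun i hi => ?_
                simp only [hc]
                rw [if_neg (by have := mem_Ico.1 hi; omega)]
            _ ≤ _ := by gcongr; exact sum_Ico_inv_le Y
        · have : 0 ≤ Real.log Y := Real.log_natCast_nonneg Y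
          positivity

theorem error_sum_le {a : ZMod q} (ha : IsUnit (2 * a)) (Y R : ℕ) {T : ℝ} (hT0 : 0 ≤ T)
    (hT : ∀ n, 0 < n → n < q * Y → (#n.divisors : ℝ) ≤ T) :
    ∑ h ∈ (univ : Finset (ZMod q)).erase 0, ‖quadSum Y (a * h)‖ ^ 2 * ‖linSum R h‖ ^ 2 ≤
      2 * (Y * (R * (q * (1 + Real.log q)))) +
      4 * (R * (T * ((R + Y * (1 + Real.log Y)) * (Y + 2 * (q * (1 + Real.log q)))))) := by
  refine (error_term_le a Y R).trans ?_
  have hq : (0 : ℝ) < q := by exact_mod_cast NeZero.pos q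
  have e1 : ∑ h ∈ Ico 1 q, (Y : ℝ) * min (R : ℝ) (q / h) ^ 2 ≤
      Y * (R * (q * (1 + Real.log q))) := by
    rw [← mul_sum]
    gcongr
    calc ∑ h ∈ Ico 1 q, min (R : ℝ) (q / h) ^ 2 ≤ ∑ h ∈ Ico 1 q, R * (q * (1 / (h : ℝ))) := by
          refine sum_le_sum fun h _ => ?_
          rw [pow_two]
          refine mul_le_mul (min_le_left _ _) ((min_le_right _ _).trans (le_of_eq (by ring)))
            (le_min (by positivity) (by positivity)) (by positivity)
      _ ≤ _ := by
          rw [← mul_sum, ← mul_sum]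
          gcongr
          exact sum_Ico_inv_le q
  have e2 : ∑ h ∈ Ico 1 q, ∑ d ∈ Ico 1 Y,
      geomBound Y (2 * a * ((h * d : ℕ) : ZMod q)) * min (R : ℝ) (q / h) ^ 2 ≤
      R * (T * ((R + Y * (1 + Real.log Y)) * (Y + 2 * (q * (1 + Real.log q))))) := by
    set F : ℕ → ℝ := fun m => min (R : ℝ) (q * Y / m) * geomBound Y (2 * a * (m : ZMod q)) with hF
    have hF0 : ∀ m, 0 ≤ F m := fun m =>
      mul_nonneg (le_min (by positivity) (by positivity)) (geomBound_nonneg _ _)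
    calc _ ≤ ∑ h ∈ Ico 1 q, ∑ d ∈ Ico 1 Y, R * F (h * d) := by
          refine sum_le_sum fun h hh => sum_le_sum fun d hd => ?_
          rw [mem_Ico] at hh hd
          have hd0 : (0 : ℝ) < d := by exact_mod_cast hd.1
          have hh0 : (0 : ℝ) < h := by exact_mod_cast hh.1
          have hdY : (d : ℝ) ≤ Y := by exact_mod_cast hd.2.le
          -- As `d < Y`, enlarging `q / h` to `qY / (hd)` makes the weight depend on the product `h
          -- d` alone. The other factor of the square is bounded by `R`.
          have hmin : min (R : ℝ) (q / h) ≤ min (R : ℝ) (q * Y / ((h * d : ℕ) : ℝ)) := by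
            refine min_le_min_left _ ?_
            push_cast
            rw [div_le_div_iff₀ hh0 (by positivity)]
            nlinarith [mul_le_mul_of_nonneg_left hdY (mul_pos hq hh0).le]
          have h0 : 0 ≤ min (R : ℝ) (q / h) := le_min (by positivity) (by positivity)
          simp only [hF]
          rw [mul_comm, ← mul_assoc]
          refine mul_le_mul_of_nonneg_right ?_ (geomBound_nonneg _ _)
          rw [pow_two]
          exact mul_le_mul (min_le_left _ _) hmin h0 (by positivity)
      _ = R * ∑ h ∈ Ico 1 q, ∑ d ∈ Ico 1 Y, F (h * d) := by simp_rw [mul_sum]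
      _ ≤ R * (T * ∑ m ∈ Ico 1 (q * Y), F m) := by
          gcongr
          exact sum_mul_le_sum_of_card_divisors_le F hF0 q Y hT
      _ ≤ _ := by
          gcongr
          exact sum_weighted_geomBound_le ha Y R
  have e3 : ∀ h ∈ Ico 1 q,
      (Y + 2 * ∑ d ∈ Ico 1 Y, geomBound Y (2 * a * ((h * d : ℕ) : ZMod q))) *
        min (R : ℝ) (q / h) ^ 2 = (Y : ℝ) * min (R : ℝ) (q / h) ^ 2 +
        2 * ∑ d ∈ Ico 1 Y,
          geomBound Y (2 * a * ((h * d : ℕ) : ZMod q)) * min (R : ℝ) (q / h) ^ 2 := by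
    intro h _
    rw [add_mul, mul_assoc, sum_mul]
  rw [sum_congr rfl e3, sum_add_distrib, ← mul_sum (Ico 1 q) _ (2 : ℝ)]
  linarith

end

end GoodPairs

/-! ### The divisor bound. -/

section DivisorBound

open Finset

theorem sum_factorization_mul_log {n : ℕ} (hn : n ≠ 0) :
    ∑ p ∈ n.primeFactors, (n.factorization p : ℝ) * Real.log p = Real.log n := by
  conv_rhs => rw [← Nat.prod_factorization_pow_eq_self hn]
  rw [Finsupp.prod, Nat.support_factorization]
  push_cast
  rw [Real.log_prod fun p hp => by
    have := (Nat.prime_of_mem_primeFactors hp).pos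
    positivity]
  simp

theorem factorization_le_log {n : ℕ} (hn : n ≠ 0) (p : ℕ) :
    (n.factorization p : ℝ) ≤ Real.log n / Real.log 2 := by
  rw [le_div_iff₀ (Real.log_pos one_lt_two)]
  by_cases hp : p ∈ n.primeFactors
  · have hp' := Nat.prime_of_mem_primeFactors hp
    have h2 : (2 : ℝ) ≤ p := by exact_mod_cast hp'.two_le
    rw [← sum_factorization_mul_log hn]
    refine le_trans ?_ (single_le_sum (f := fun p : ℕ => (n.factorization p : ℝ) * Real.log p)
      (fun i _ => mul_nonneg (by positivity) (Real.log_natCast_nonneg i)) hp)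
    gcongr
  · have h0 : n.factorization p = 0 := Finsupp.notMem_support_iff.1 hp
    rw [h0]
    simpa using Real.log_natCast_nonneg n

/-- In `τ(n) = ∏ (v_p + 1)`, at most `P` primes are `≤ P`, each giving at most `1 + log N / log 2`.
For `p > P` one has `v_p + 1 ≤ 2^(v_p) ≤ p^(κ v_p)` with `κ = log 2 / log P`, for a total of at most
`n^κ`. -/
theorem card_divisors_le_of_threshold {n : ℕ} (hn : n ≠ 0) {N P : ℝ} (hnN : (n : ℝ) ≤ N)
    (hP : 1 < P) :
    (#n.divisors : ℝ) ≤
      (1 + Real.log N / Real.log 2) ^ P * Real.exp (Real.log 2 / Real.log P * Real.log N) := by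
  have hn1 : (1 : ℝ) ≤ n := by exact_mod_cast Nat.one_le_iff_ne_zero.2 hn
  have hlog : Real.log n ≤ Real.log N := Real.log_le_log (by linarith) hnN
  have hlog0 : 0 ≤ Real.log N := Real.log_nonneg (by linarith)
  have hl2 : 0 < Real.log 2 := Real.log_pos one_lt_two
  have hlP : 0 < Real.log P := Real.log_pos hP
  set A : ℝ := 1 + Real.log N / Real.log 2 with hA
  have hA1 : 1 ≤ A := by rw [hA]; linarith [div_nonneg hlog0 hl2.le]
  set κ : ℝ := Real.log 2 / Real.log P with hκ
  have hκ0 : 0 ≤ κ := by positivity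
  rw [Nat.card_divisors hn]
  push_cast
  calc ∏ p ∈ n.primeFactors, ((n.factorization p : ℝ) + 1)
      ≤ ∏ p ∈ n.primeFactors, ((if (p : ℝ) ≤ P then A else 1) *
          Real.exp (κ * (n.factorization p * Real.log p))) := by
        refine prod_le_prod (fun _ _ => by positivity) fun p hp => ?_
        have hlp : 0 ≤ Real.log p := Real.log_natCast_nonneg p
        split_ifs with h
        · have h1 : (n.factorization p : ℝ) + 1 ≤ A := by
            have h2 := factorization_le_log hn p
            have h3 : Real.log n / Real.log 2 ≤ Real.log N / Real.log 2 := by gcongr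
            linarith
          have h2 : 1 ≤ Real.exp (κ * (n.factorization p * Real.log p)) :=
            Real.one_le_exp (by positivity)
          nlinarith
        · have h1 : ((n.factorization p + 1 : ℕ) : ℝ) ≤ 2 ^ n.factorization p := by
            exact_mod_cast Nat.lt_two_pow_self
          have h2 : (2 : ℝ) ^ n.factorization p = Real.exp (n.factorization p * Real.log 2) := by
            rw [Real.exp_nat_mul, Real.exp_log two_pos]
          rw [one_mul]
          push_cast at h1
          refine h1.trans (h2.le.trans (Real.exp_le_exp.2 ?_))
          have h3 : Real.log P ≤ Real.log p := Real.log_le_log (by linarith) (by linarith)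
          have h4 : Real.log 2 ≤ κ * Real.log p := by
            calc Real.log 2 = κ * Real.log P := by rw [hκ]; field_simp
              _ ≤ _ := by gcongr
          calc _ ≤ (n.factorization p : ℝ) * (κ * Real.log p) := by gcongr
            _ = _ := by ring
    _ = A ^ #{p ∈ n.primeFactors | ((p : ℕ) : ℝ) ≤ P} * Real.exp (κ * Real.log n) := by
        rw [prod_mul_distrib, ← Real.exp_sum, ← mul_sum, sum_factorization_mul_log hn,
          prod_ite, prod_const, prod_const_one, mul_one]
    _ ≤ A ^ P * Real.exp (κ * Real.log N) := by
        gcongr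
        rw [← Real.rpow_natCast]
        refine Real.rpow_le_rpow_of_exponent_le hA1 ?_
        have hsub : {p ∈ n.primeFactors | ((p : ℕ) : ℝ) ≤ P} ⊆ Icc 1 ⌊P⌋₊ := by
          intro p hp
          rw [mem_filter] at hp
          exact mem_Icc.2 ⟨(Nat.prime_of_mem_primeFactors hp.1).pos, Nat.le_floor hp.2⟩
        have := card_le_card hsub
        rw [Nat.card_Icc, Nat.add_sub_cancel] at this
        exact (Nat.cast_le.2 this).trans (Nat.floor_le (by linarith))

/-- The divisor bound `τ(n) ≤ N ^ (24 / log log N)` for `n ≤ N`. -/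
theorem card_divisors_le_exp {n : ℕ} (hn : n ≠ 0) {N : ℝ} (hnN : (n : ℝ) ≤ N)
    (hN : 1 < Real.log N) :
    (#n.divisors : ℝ) ≤ Real.exp (24 * (Real.log N / Real.log (Real.log N))) := by
  set L := Real.log N with hL
  have hL0 : 0 < L := by linarith
  have hlL : 0 < Real.log L := Real.log_pos hN
  have hl2 : 1 / 2 < Real.log 2 := by linarith [Real.log_two_gt_d9]
  have hl2' : Real.log 2 < 1 := by linarith [Real.log_two_lt_d9]
  -- The threshold between small and large primes is `P = √(log N)`.
  have hs1 : 1 < Real.sqrt L := by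
    rw [Real.lt_sqrt (by norm_num)]; linarith
  refine (card_divisors_le_of_threshold hn hnN hs1).trans ?_
  have hB : 1 + L / Real.log 2 ≤ 3 * L := by
    have : L / Real.log 2 ≤ 2 * L := by
      rw [div_le_iff₀ (by linarith)]; nlinarith
    linarith
  have hB0 : 0 < 1 + L / Real.log 2 := by positivity
  rw [Real.rpow_def_of_pos hB0, ← Real.exp_add]
  refine Real.exp_le_exp.2 ?_
  rw [Real.log_sqrt hL0.le]
  -- Both logarithms are bounded by multiples of `L^(1/4)`: small primes give `5.5 · 4 = 22`, large
  -- primes `2`, in total `24`.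
  set r := L ^ (1 / 4 : ℝ) with hr
  have hr0 : 0 < r := by positivity
  have hr4 : r ^ 4 = L := by
    rw [hr, ← Real.rpow_natCast, ← Real.rpow_mul hL0.le]; norm_num
  have hsq : Real.sqrt L = r ^ 2 := by
    rw [Real.sqrt_eq_iff_eq_sq hL0.le (by positivity)]
    rw [← hr4]; ring
  have h1 : Real.log L ≤ 4 * r := by
    have := Real.log_le_rpow_div hL0.le (show (0 : ℝ) < 1 / 4 by norm_num)
    rw [← hr] at this; linarith
  have h2 : Real.log (1 + L / Real.log 2) ≤ 5.5 * r := by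
    refine (Real.log_le_log hB0 hB).trans ?_
    have := Real.log_le_rpow_div (show 0 ≤ 3 * L by positivity) (show (0 : ℝ) < 1 / 4 by norm_num)
    rw [Real.mul_rpow (by norm_num) hL0.le, ← hr] at this
    have h3 : (3 : ℝ) ^ (1 / 4 : ℝ) ≤ 1.375 := by
      refine (Real.rpow_le_rpow (by norm_num) (show (3 : ℝ) ≤ 1.375 ^ (4 : ℕ) by norm_num)
        (by norm_num)).trans (le_of_eq ?_)
      rw [← Real.rpow_natCast, ← Real.rpow_mul (by norm_num)]; norm_num
    nlinarith
  have h5 : Real.log (1 + L / Real.log 2) * r ^ 2 ≤ 22 * (L / Real.log L) := by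
    rw [← mul_div_assoc, le_div_iff₀ hlL]
    calc Real.log (1 + L / Real.log 2) * r ^ 2 * Real.log L ≤ 5.5 * r * r ^ 2 * (4 * r) := by gcongr
      _ = 22 * L := by rw [← hr4]; ring
  have h6 : Real.log 2 / (Real.log L / 2) * L ≤ 2 * (L / Real.log L) := by
    calc Real.log 2 / (Real.log L / 2) * L = Real.log 2 * (2 * (L / Real.log L)) := by field_simp
      _ ≤ 1 * (2 * (L / Real.log L)) := by gcongr
      _ = _ := one_mul _
  rw [hsq]
  linarith

end DivisorBound

/-! ### Multiplicity of representations by two squares. -/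

section TwoSquares

open Finset

/-- Fix one representation `(x₀, y₀)` and send `(x, y)` to `f = gcd (n, x y₀ - y x₀)`. Since `n`
divides `(x y₀ - y x₀)(x y₀ + y x₀)`, the cofactor `n / f` divides the second factor. It is coprime
to `f`: a common divisor divides `2 x y₀`, hence `2`, and `4 ∣ n` would make `x`, `y` both even. If
two representations share `f`, then `f` and `n / f` both divide their cross determinant; it is
smaller than `n` in absolute value, so it vanishes and coprimality forces equality. -/
theorem card_primitive_repr_le {n : ℕ} (hn : 0 < n) (s : Finset (ℕ × ℕ))
    (hs : ∀ p ∈ s, 0 < p.1 ∧ 0 < p.2 ∧ p.1.Coprime p.2 ∧ p.1 ^ 2 + p.2 ^ 2 = n) :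
    #s ≤ #n.divisors := by
  rcases s.eq_empty_or_nonempty with rfl | ⟨⟨x₀, y₀⟩, h₀⟩
  · simp
  obtain ⟨hx₀, hy₀, hc₀, hn₀⟩ := hs _ h₀
  simp only at hx₀ hy₀ hc₀ hn₀
  have hcopY : ∀ x y : ℕ, x.Coprime y → x ^ 2 + y ^ 2 = n → IsCoprime (y : ℤ) n := by
    intro x y h hxy
    rw [Nat.isCoprime_iff_coprime, ← hxy]
    have : Nat.Coprime y (x ^ 2) := (h.symm).pow_right 2
    rw [pow_two y]
    simpa using this
  have hcopX : ∀ x y : ℕ, x.Coprime y → x ^ 2 + y ^ 2 = n → IsCoprime (x : ℤ) n := by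
    intro x y h hxy
    exact hcopY y x h.symm (by rw [add_comm]; exact hxy)
  set u : ℕ × ℕ → ℤ := fun p => p.1 * y₀ - p.2 * x₀ with hu
  set v : ℕ × ℕ → ℤ := fun p => p.1 * y₀ + p.2 * x₀ with hv
  set f : ℕ × ℕ → ℕ := fun p => Int.gcd n (u p) with hf
  have hn₀' : (x₀ : ℤ) ^ 2 + (y₀ : ℤ) ^ 2 = n := by exact_mod_cast hn₀
  have hfdvd : ∀ p, f p ∣ n := fun p => by
    have := Int.gcd_dvd_left (n : ℤ) (u p)
    exact_mod_cast this
  have hcof : ∀ p ∈ s, ((n / f p : ℕ) : ℤ) ∣ v p := by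
    intro p hp
    have hpn : (p.1 : ℤ) ^ 2 + (p.2 : ℤ) ^ 2 = n := by exact_mod_cast (hs p hp).2.2.2
    have h1 : (n : ℤ) ∣ u p * v p := ⟨(y₀ : ℤ) ^ 2 - (p.2 : ℤ) ^ 2, by
      simp only [hu, hv]
      have e1 : (p.1 : ℤ) ^ 2 = n - (p.2 : ℤ) ^ 2 := by linarith
      have e2 : (x₀ : ℤ) ^ 2 = n - (y₀ : ℤ) ^ 2 := by linarith
      calc _ = (p.1 : ℤ) ^ 2 * (y₀ : ℤ) ^ 2 - (p.2 : ℤ) ^ 2 * (x₀ : ℤ) ^ 2 := by ring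
        _ = _ := by rw [e1, e2]; ring⟩
    have h2 : n ∣ f p * (v p).natAbs := by
      have := Int.natAbs_dvd_natAbs.2 h1
      rw [Int.natAbs_mul, Int.natAbs_natCast] at this
      exact dvd_gcd_mul_of_dvd_mul this
    have h3 : n / f p ∣ (v p).natAbs := by
      rw [← Nat.div_mul_cancel (hfdvd p), mul_comm] at h2
      exact Nat.dvd_of_mul_dvd_mul_left (Nat.pos_of_dvd_of_pos (hfdvd p) hn) h2
    exact Int.natCast_dvd.2 h3
  have hcoprime : ∀ p ∈ s, IsCoprime ((f p : ℕ) : ℤ) ((n / f p : ℕ) : ℤ) := by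
    intro p hp
    rw [Nat.isCoprime_iff_coprime]
    set g := Nat.gcd (f p) (n / f p) with hg
    have hgn : g * g ∣ n := by
      calc g * g ∣ f p * (n / f p) := mul_dvd_mul (Nat.gcd_dvd_left _ _) (Nat.gcd_dvd_right _ _)
        _ = n := Nat.mul_div_cancel' (hfdvd p)
    have hg1 : (g : ℤ) ∣ u p := (Int.natCast_dvd_natCast.2 (Nat.gcd_dvd_left _ _)).trans
      (Int.gcd_dvd_right (n : ℤ) (u p))
    have hg2 : (g : ℤ) ∣ v p := (Int.natCast_dvd_natCast.2 (Nat.gcd_dvd_right _ _)).trans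
      (hcof p hp)
    have hgn' : (g : ℤ) ∣ n := Int.natCast_dvd_natCast.2 ((dvd_mul_left g g).trans hgn)
    have hcp := (hs p hp).2.2
    have h1 : (g : ℤ) ∣ (p.1 * y₀) * 2 := by
      have := dvd_add hg1 hg2
      rwa [show u p + v p = (p.1 * y₀) * 2 by simp only [hu, hv]; ring] at this
    have h2 : (g : ℤ) ∣ 2 := by
      refine IsCoprime.dvd_of_dvd_mul_left ?_ h1
      exact (IsCoprime.mul_left (hcopX p.1 p.2 hcp.1 hcp.2)
        (hcopY x₀ y₀ hc₀ hn₀)).symm.of_isCoprime_of_dvd_left hgn'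
    have h3 : g ∣ 2 := by exact_mod_cast h2
    rcases (Nat.dvd_prime Nat.prime_two).1 h3 with h | h
    · exact h
    · exfalso
      rw [h] at hgn
      have e := hcp.2
      have h4 : (p.1 ^ 2 + p.2 ^ 2) % 4 = 0 := by rw [e]; omega
      have hx : p.1 % 2 = 0 ∧ p.2 % 2 = 0 := by
        rw [Nat.add_mod, Nat.pow_mod p.1, Nat.pow_mod p.2] at h4
        have a1 : p.1 % 4 < 4 := Nat.mod_lt _ (by norm_num)
        have a2 : p.2 % 4 < 4 := Nat.mod_lt _ (by norm_num)
        generalize hb1 : p.1 % 4 = b1 at *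
        generalize hb2 : p.2 % 4 = b2 at *
        interval_cases b1 <;> interval_cases b2 <;> simp at h4 <;> omega
      have := Nat.dvd_gcd (Nat.dvd_of_mod_eq_zero hx.1) (Nat.dvd_of_mod_eq_zero hx.2)
      rw [hcp.1] at this
      omega
  refine card_le_card_of_injOn f (fun p _ => Nat.mem_divisors.2 ⟨hfdvd p, hn.ne'⟩) ?_
  intro p hp r hr hpr
  have hcy := hcopY x₀ y₀ hc₀ hn₀
  obtain ⟨hp1, hp2, hpc, hpn⟩ := hs p hp
  obtain ⟨hr1, hr2, hrc, hrn⟩ := hs r hr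
  set w : ℤ := p.1 * r.2 - r.1 * p.2 with hw
  have hd1 : ((f p : ℕ) : ℤ) ∣ w := by
    have h1 : ((f p : ℕ) : ℤ) ∣ u p := Int.gcd_dvd_right (n : ℤ) (u p)
    have h2 : ((f p : ℕ) : ℤ) ∣ u r := by
      rw [hpr]; exact Int.gcd_dvd_right (n : ℤ) (u r)
    have h3 : ((f p : ℕ) : ℤ) ∣ y₀ * w := by
      have := dvd_sub (h1.mul_left (r.2 : ℤ)) (h2.mul_left (p.2 : ℤ))
      rwa [show (r.2 : ℤ) * u p - p.2 * u r = y₀ * w by simp only [hu, hw]; ring] at this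
    exact IsCoprime.dvd_of_dvd_mul_left
      (hcy.symm.of_isCoprime_of_dvd_left (Int.natCast_dvd_natCast.2 (hfdvd p))) h3
  have hd2 : ((n / f p : ℕ) : ℤ) ∣ w := by
    have h1 := hcof p hp
    have h2 : ((n / f p : ℕ) : ℤ) ∣ v r := by
      rw [hpr]; exact hcof r hr
    have h3 : ((n / f p : ℕ) : ℤ) ∣ y₀ * w := by
      have := dvd_sub (h1.mul_left (r.2 : ℤ)) (h2.mul_left (p.2 : ℤ))
      rwa [show (r.2 : ℤ) * v p - p.2 * v r = y₀ * w by simp only [hv, hw]; ring] at this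
    exact IsCoprime.dvd_of_dvd_mul_left (hcy.symm.of_isCoprime_of_dvd_left
      (Int.natCast_dvd_natCast.2 (Nat.div_dvd_of_dvd (hfdvd p)))) h3
  have hnw : (n : ℤ) ∣ w := by
    have := (hcoprime p hp).mul_dvd hd1 hd2
    rwa [← Nat.cast_mul, Nat.mul_div_cancel' (hfdvd p)] at this
  have hlt : ∀ A B C D : ℕ, 0 < B → 0 < C → A ^ 2 + B ^ 2 = n → C ^ 2 + D ^ 2 = n → A * D < n := by
    intro A B C D hB hC h1 h2
    nlinarith [sq_nonneg ((A : ℤ) - D), Nat.mul_self_le_mul_self hB, Nat.mul_self_le_mul_self hC,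
      two_mul_le_add_sq A D]
  have hw0 : w = 0 := by
    refine Int.eq_zero_of_abs_lt_dvd hnw ?_
    have a1 : ((p.1 * r.2 : ℕ) : ℤ) < n := by
      exact_mod_cast hlt p.1 p.2 r.1 r.2 hp2 hr1 hpn hrn
    have a2 : ((r.1 * p.2 : ℕ) : ℤ) < n := by
      exact_mod_cast hlt r.1 r.2 p.1 p.2 hr2 hp1 hrn hpn
    have b1 : (0 : ℤ) ≤ ((p.1 * r.2 : ℕ) : ℤ) := by positivity
    have b2 : (0 : ℤ) ≤ ((r.1 * p.2 : ℕ) : ℤ) := by positivity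
    push_cast at a1 a2 b1 b2
    rw [abs_lt]
    constructor <;> simp only [hw] <;> linarith
  have hcross : p.1 * r.2 = r.1 * p.2 := by
    have : (p.1 : ℤ) * r.2 = r.1 * p.2 := by simp only [hw] at hw0; linarith
    exact_mod_cast this
  have e1 : p.1 = r.1 := by
    refine Nat.dvd_antisymm ?_ ?_
    · exact hpc.dvd_of_dvd_mul_right (Dvd.intro _ hcross)
    · exact hrc.dvd_of_dvd_mul_right (Dvd.intro _ hcross.symm)
  refine Prod.ext e1 ?_
  rw [e1] at hcross
  exact (Nat.eq_of_mul_eq_mul_left hr1 hcross).symm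

/-- The number of representations as a sum of two positive squares is at most `τ(n)²`. -/
theorem card_repr_le {n : ℕ} (hn : 0 < n) (s : Finset (ℕ × ℕ))
    (hs : ∀ p ∈ s, 0 < p.1 ∧ 0 < p.2 ∧ p.1 ^ 2 + p.2 ^ 2 = n) :
    #s ≤ #n.divisors * #n.divisors := by
  have hdvd : ∀ p ∈ s, p.1.gcd p.2 ^ 2 ∣ n := by
    intro p hp
    rw [← (hs p hp).2.2]
    exact dvd_add (pow_dvd_pow_of_dvd (Nat.gcd_dvd_left _ _) 2)
      (pow_dvd_pow_of_dvd (Nat.gcd_dvd_right _ _) 2)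
  -- Sort by the gcd `g`, a divisor of `n`; dividing out `g` leaves primitive representations of `n
  -- / g²`.
  refine card_le_mul_card_image_of_maps_to (f := fun p : ℕ × ℕ => p.1.gcd p.2) ?_ _ ?_
  · intro p hp
    exact Nat.mem_divisors.2 ⟨(dvd_pow_self _ two_ne_zero).trans (hdvd p hp), hn.ne'⟩
  intro g hg
  have hg0 : 0 < g := Nat.pos_of_mem_divisors hg
  by_cases hgn : g ^ 2 ∣ n
  · have hm : 0 < n / g ^ 2 := Nat.div_pos (Nat.le_of_dvd hn hgn) (by positivity)
    set t := {p ∈ s | p.1.gcd p.2 = g} with ht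
    have hmem : ∀ p ∈ t, g * (p.1 / g) = p.1 ∧ g * (p.2 / g) = p.2 := by
      intro p hp
      have h := (mem_filter.1 hp).2
      exact ⟨Nat.mul_div_cancel' (h ▸ Nat.gcd_dvd_left _ _),
        Nat.mul_div_cancel' (h ▸ Nat.gcd_dvd_right _ _)⟩
    have hinj : Set.InjOn (fun p : ℕ × ℕ => (p.1 / g, p.2 / g)) t := by
      intro p hp r hr h
      simp only [Prod.mk.injEq] at h
      refine Prod.ext ?_ ?_
      · rw [← (hmem p hp).1, ← (hmem r hr).1, h.1]
      · rw [← (hmem p hp).2, ← (hmem r hr).2, h.2]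
    rw [← card_image_of_injOn hinj]
    refine (card_primitive_repr_le hm _ ?_).trans
      (card_le_card (Nat.divisors_subset_of_dvd hn.ne' (Nat.div_dvd_of_dvd hgn)))
    intro r hr
    obtain ⟨p, hp, rfl⟩ := mem_image.1 hr
    obtain ⟨h1, h2⟩ := hmem p hp
    obtain ⟨hps, hpg⟩ := mem_filter.1 hp
    obtain ⟨hp1, hp2, hpn⟩ := hs p hps
    refine ⟨?_, ?_, ?_, ?_⟩
    · exact Nat.pos_of_ne_zero fun h => by simp only at h; rw [h] at h1; omega
    · exact Nat.pos_of_ne_zero fun h => by simp only at h; rw [h] at h2; omega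
    · simp only
      rw [← hpg]
      exact Nat.coprime_div_gcd_div_gcd (hpg ▸ hg0)
    · simp only
      rw [eq_comm, Nat.div_eq_iff_eq_mul_right (by positivity) hgn]
      calc n = (g * (p.1 / g)) ^ 2 + (g * (p.2 / g)) ^ 2 := by rw [h1, h2, hpn]
        _ = _ := by ring
  · rw [filter_eq_empty_iff.2]
    · simp
    · intro p hp h
      exact hgn (h ▸ hdvd p hp)

end TwoSquares

/-! ### Existence of admissible fractions. -/

section AdmissibleFractions

open Finset

/-- Dirichlet gives infinitely many approximations, while bounded denominators would bound the
numerators too. -/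
theorem exists_rat_approx_den_gt {α : ℝ} (hα : Irrational α) (Q : ℕ) :
    ∃ r : ℚ, Q < r.den ∧ |α - r| < 1 / (r.den : ℝ) ^ 2 := by
  by_contra! hcon
  refine Real.infinite_rat_abs_sub_lt_one_div_den_sq_of_irrational hα ?_
  set B : ℤ := ⌈(Q : ℝ) * (|α| + 1)⌉ with hB
  refine Set.Finite.of_finite_image (f := fun r : ℚ => (r.num, r.den)) ?_ ?_
  · refine Set.Finite.subset ((Set.finite_Icc (-B) B).prod (Set.finite_Iic Q)) ?_
    rintro _ ⟨r, hr, rfl⟩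
    have hr' : |α - r| < 1 / (r.den : ℝ) ^ 2 := hr
    have hden : r.den ≤ Q := by
      by_contra h
      exact absurd hr' (not_lt.2 (hcon r (by omega)))
    refine ⟨?_, hden⟩
    have hd1 : (1 : ℝ) ≤ r.den := by exact_mod_cast r.pos
    have hle : 1 / (r.den : ℝ) ^ 2 ≤ 1 := by
      rw [div_le_one (by positivity)]; exact one_le_pow₀ hd1
    have habs : |(r : ℝ)| ≤ |α| + 1 := by
      have h1 : |(r : ℝ)| ≤ |α| + |α - r| := by
        calc |(r : ℝ)| = |α - (α - r)| := by ring_nf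
          _ ≤ _ := abs_sub _ _
      linarith
    have hnum : |(r.num : ℝ)| ≤ (Q : ℝ) * (|α| + 1) := by
      have h2 : (r.num : ℝ) = r.den * r := by
        rw [Rat.cast_def]; field_simp
      rw [h2, abs_mul, Nat.abs_cast]
      have : (r.den : ℝ) ≤ Q := by exact_mod_cast hden
      gcongr
    have h3 := abs_le.1 (hnum.trans (Int.le_ceil _))
    exact Set.mem_Icc.2 ⟨by exact_mod_cast h3.1, by exact_mod_cast h3.2⟩
  · intro r _ s _ h
    simp only [Prod.mk.injEq] at h
    exact Rat.ext h.1 h.2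

theorem gcd_two_mul_eq_one {a : ℤ} {q : ℕ} (hq : Odd q) (h : IsCoprime a (q : ℤ)) :
    Int.gcd (2 * a) (q : ℤ) = 1 := by
  rw [← Int.isCoprime_iff_gcd_eq_one]
  refine IsCoprime.mul_left ?_ h
  have := (Nat.coprime_two_left.2 hq)
  exact_mod_cast Nat.isCoprime_iff_coprime.2 this

theorem exists_admissible_gt {α : ℝ} (hα : Irrational α) (Q : ℕ) :
    ∃ (a : ℤ) (q : ℕ), Q < q ∧ IsAdmissibleFraction α a q := by
  obtain ⟨r, hrQ, hr⟩ := exists_rat_approx_den_gt hα (Q + 1)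
  have hcop : IsCoprime r.num (r.den : ℤ) := by
    rw [Int.isCoprime_iff_gcd_eq_one]
    exact r.reduced
  set a := r.num with ha
  set q := r.den with hq
  have hq0 : (0 : ℝ) < q := by exact_mod_cast (by omega : 0 < q)
  have hr2 : |α - (a : ℝ) / q| < 1 / (q : ℝ) ^ 2 := by
    rwa [Rat.cast_def] at hr
  rcases Nat.even_or_odd q with heven | hodd
  -- For even `q`, pass to `c / (q + b)` with `a (q + b) - c q = 1`, where `b` is the inverse of `a`
  -- mod `q`. The determinant forces `q + b` to be odd, and `q + b < 2q` keeps the error below `(4 +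
  -- 2) / (q + b)²`.
  · obtain ⟨u, v, huv⟩ := hcop
    have hqz : (0 : ℤ) < q := by exact_mod_cast (by omega : 0 < q)
    have hb0 : 0 ≤ u % q := Int.emod_nonneg _ hqz.ne'
    have hb1 : u % q < q := Int.emod_lt_of_pos _ hqz
    obtain ⟨b, hb⟩ := Int.eq_ofNat_of_zero_le hb0
    have hbq : b < q := by
      rw [hb] at hb1; exact_mod_cast hb1
    have hub : (b : ℤ) = u - q * (u / q) := by
      rw [← hb]; exact eq_sub_of_add_eq (Int.emod_add_mul_ediv u q)
    set c : ℤ := a - v - a * (u / q) with hc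
    have hdet : a * ((q + b : ℕ) : ℤ) - c * q = 1 := by
      push_cast
      rw [hub, hc, ← huv]; ring
    have hcop1 : IsCoprime c ((q + b : ℕ) : ℤ) := ⟨-q, a, by rw [← hdet]; ring⟩
    have hodd' : Odd (q + b) := by
      by_contra hne
      rw [Nat.not_odd_iff_even] at hne
      obtain ⟨k, hk⟩ := heven
      obtain ⟨l, hl⟩ := hne
      rw [hl] at hdet
      have hk' : (q : ℤ) = k + k := by exact_mod_cast hk
      rw [hk'] at hdet
      push_cast at hdet
      have : (2 : ℤ) ∣ 1 := ⟨a * l - c * k, by rw [← hdet]; ring⟩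
      omega
    refine ⟨c, q + b, by omega, by omega, gcd_two_mul_eq_one hodd' hcop1, ?_⟩
    set q' : ℝ := ((q + b : ℕ) : ℝ) with hq'
    have hq'q : (q : ℝ) ≤ q' := by rw [hq']; push_cast; linarith [(Nat.cast_nonneg b : (0:ℝ) ≤ b)]
    have hq'2 : q' ≤ 2 * q := by
      have : (b : ℝ) < q := by exact_mod_cast hbq
      rw [hq']; push_cast; linarith
    have hq'0 : 0 < q' := by linarith
    have hdet' : (a : ℝ) * q' - c * q = 1 := by
      rw [hq']; exact_mod_cast hdet
    have hdiff : (a : ℝ) / q - c / q' = 1 / (q * q') := by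
      rw [← hdet']; field_simp
    have h1 : |α - (c : ℝ) / q'| ≤ 1 / (q : ℝ) ^ 2 + 1 / (q * q') := by
      calc |α - (c : ℝ) / q'| = |(α - a / q) + (a / q - c / q')| := by ring_nf
        _ ≤ |α - a / q| + |(a : ℝ) / q - c / q'| := abs_add_le _ _
        _ ≤ _ := by
            rw [hdiff, abs_of_pos (by positivity : 0 < 1 / (q * q'))]
            linarith
    refine h1.trans_lt ?_
    have e1 : 1 / (q : ℝ) ^ 2 ≤ 4 / q' ^ 2 := by
      rw [div_le_div_iff₀ (by positivity) (by positivity)]; nlinarith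
    have e2 : 1 / (q * q') ≤ 2 / q' ^ 2 := by
      rw [div_le_div_iff₀ (by positivity) (by positivity)]; nlinarith
    have e3 : 4 / q' ^ 2 + 2 / q' ^ 2 < 24 / q' ^ 2 := by
      rw [← add_div]; gcongr; norm_num
    linarith
  · refine ⟨a, q, by omega, by omega, gcd_two_mul_eq_one hodd hcop, hr2.trans_le ?_⟩
    gcongr; norm_num

theorem infinite_admissible {α : ℝ} (hα : Irrational α) :
    {r : ℚ | ∃ (a : ℤ) (q : ℕ), IsAdmissibleFraction α a q ∧ r = (a : ℚ) / (q : ℚ)}.Infinite := by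
  intro hfin
  obtain ⟨B, hB⟩ := (hfin.image (fun r : ℚ => r.den)).bddAbove
  obtain ⟨a, q, hq, hadm⟩ := exists_admissible_gt hα B
  have hden : ((a : ℚ) / (q : ℚ)).den = q := by
    have h1 : Nat.Coprime a.natAbs q := by
      have h := hadm.2.1
      rw [← Int.isCoprime_iff_gcd_eq_one] at h
      have h2 := Int.isCoprime_iff_gcd_eq_one.1 h.of_mul_left_right
      simpa [Int.gcd] using h2
    have := Rat.den_div_eq_of_coprime (a := a) (b := (q : ℤ)) (by omega) (by simpa using h1)
    exact_mod_cast this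
  have := hB ⟨_, ⟨a, q, hadm, rfl⟩, rfl⟩
  simp only [hden] at this
  omega

end AdmissibleFractions

/-! ### From good pairs to sums of two squares near multiples of `1 / α`. -/

section Counting

open Finset Filter Topology

theorem eventually_divisor_factor_le {ε : ℝ} (hε : 0 < ε) : ∀ᶠ q : ℝ in atTop,
    Real.exp (24 * (Real.log (q ^ 2) / Real.log (Real.log (q ^ 2)))) ≤ q ^ ε := by
  have h1 : Tendsto (fun q : ℝ => Real.log (Real.log (q ^ 2))) atTop atTop :=
    Real.tendsto_log_atTop.comp (Real.tendsto_log_atTop.comp (tendsto_pow_atTop two_ne_zero))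
  filter_upwards [h1.eventually_ge_atTop (48 / ε), eventually_gt_atTop 1] with q hq hq1
  have hl : 0 < Real.log (Real.log (q ^ 2)) := lt_of_lt_of_le (by positivity) hq
  have hlq : 0 < Real.log q := Real.log_pos hq1
  rw [Real.rpow_def_of_pos (by linarith)]
  refine Real.exp_le_exp.2 ?_
  rw [← mul_div_assoc, div_le_iff₀ hl, Real.log_pow]
  rw [div_le_iff₀ hε] at hq
  rw [Real.log_pow] at hq
  push_cast at hq ⊢
  nlinarith

theorem eventually_log_factor_le {ε : ℝ} (hε : 0 < ε) : ∀ᶠ q : ℝ in atTop,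
    208 * (1 + Real.log q) ^ 2 ≤ q ^ ε := by
  have h1 : Tendsto (fun q : ℝ => (1 + Real.log q) ^ 2 / q ^ ε) atTop (𝓝 0) := by
    have h2 : (fun q : ℝ => 1 + Real.log q) =o[atTop] fun q : ℝ => q ^ (ε / 2) := by
      refine Asymptotics.IsLittleO.add ?_ (isLittleO_log_rpow_atTop (by positivity))
      exact Asymptotics.isLittleO_const_left.2 (Or.inr (tendsto_norm_atTop_atTop.comp
        (tendsto_rpow_atTop (by positivity))))
    have h3 := (h2.pow (n := 2) (by norm_num)).tendsto_div_nhds_zero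
    refine h3.congr' ?_
    filter_upwards [eventually_gt_atTop 0] with q hq
    rw [← Real.rpow_natCast (q ^ (ε / 2)), ← Real.rpow_mul hq.le]
    norm_num
  filter_upwards [h1.eventually_le_const (show (0 : ℝ) < 1 / 208 by norm_num),
    eventually_gt_atTop 0] with q hq hq0
  rw [div_le_iff₀ (by positivity)] at hq
  linarith

theorem half_le_floor {x : ℝ} (hx : 1 ≤ x) : x / 2 ≤ (⌊x⌋₊ : ℝ) := by
  have h1 := Nat.lt_floor_add_one x
  have h2 : (1 : ℝ) ≤ ⌊x⌋₊ := by exact_mod_cast Nat.le_floor (by simpa using hx)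
  linarith

theorem error_bound_simplify {Y R q T l L : ℝ} (hR : 0 ≤ R) (hY : 0 ≤ Y) (hRY : R ≤ Y)
    (hYq : Y ≤ q) (hT : 1 ≤ T) (hl : 0 ≤ l) (hlL : l ≤ L) :
    2 * (Y * (R * (q * (1 + L)))) + 4 * (R * (T * ((R + Y * (1 + l)) *
      (Y + 2 * (q * (1 + L)))))) ≤ 26 * (R * Y) * (q * (T * (1 + L) ^ 2)) := by
  have hq : 0 ≤ q := hY.trans hYq
  have hL : 0 ≤ L := hl.trans hlL
  have a1 : R + Y * (1 + l) ≤ 2 * (Y * (1 + L)) := by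
    have h1 : Y * (1 + l) ≤ Y * (1 + L) := by gcongr
    have h2 : 0 ≤ Y * L := by positivity
    linarith
  have a2 : Y + 2 * (q * (1 + L)) ≤ 3 * (q * (1 + L)) := by
    have h2 : 0 ≤ q * L := by positivity
    linarith
  have a3 : 1 + L ≤ T * (1 + L) ^ 2 := by
    have h1 : 1 ≤ T * (1 + L) := one_le_mul_of_one_le_of_one_le hT (by linarith)
    have h2 := mul_le_mul_of_nonneg_right h1 (by linarith : 0 ≤ 1 + L)
    linarith
  calc _ ≤ 2 * (Y * (R * (q * (T * (1 + L) ^ 2)))) +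
        4 * (R * (T * (2 * (Y * (1 + L)) * (3 * (q * (1 + L)))))) := by gcongr
    _ = _ := by ring

theorem expected_count_le {q β Y R : ℝ} (hq : 0 < q) (hY : q ^ ((1 + β) / 2) / 2 ≤ Y)
    (hR : q ^ β / 2 ≤ R) : q ^ (2 * β) * q / 8 ≤ Y ^ 2 * R := by
  calc q ^ (2 * β) * q / 8 = (q ^ ((1 + β) / 2) / 2) ^ 2 * (q ^ β / 2) := by
        rw [div_pow, ← Real.rpow_natCast (q ^ ((1 + β) / 2)), ← Real.rpow_mul hq.le]
        have : q ^ (2 * β) * q = q ^ ((1 + β) / 2 * (2 : ℕ)) * q ^ β := by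
          rw [← Real.rpow_add_one hq.ne', ← Real.rpow_add hq]
          congr 1; push_cast; ring
        rw [this]; ring
    _ ≤ _ := by gcongr

/-- For large `q`, the good pairs are at least half as many as expected. -/
theorem exists_forall_le_card_goodPairs {ε : ℝ} (hε : 0 < ε) : ∃ Q : ℕ, ∀ (q : ℕ) [NeZero q],
    Q ≤ q → ∀ a : ZMod q, IsUnit (2 * a) → ∀ β : ℝ, 1 / 3 + 6 * ε < β → β < 1 →
    (q : ℝ) ^ (2 * β) / 16 ≤ #(goodPairs a ⌊(q : ℝ) ^ ((1 + β) / 2)⌋₊ ⌊(q : ℝ) ^ β⌋₊) := by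
  obtain ⟨Q, hQ⟩ := eventually_atTop.1 (tendsto_natCast_atTop_atTop.eventually
    ((eventually_divisor_factor_le hε).and (eventually_log_factor_le hε)))
  refine ⟨max Q 3, fun q _ hq a ha β hβ hβ1 => ?_⟩
  obtain ⟨hT, hlog⟩ := hQ q (le_of_max_le_left hq)
  have hq3 : (3 : ℝ) ≤ q := by exact_mod_cast le_of_max_le_right hq
  have hq0 : (0 : ℝ) < q := by linarith
  have hq1 : (1 : ℝ) ≤ q := by linarith
  have hβ0 : 0 < β := by linarith
  set T := Real.exp (24 * (Real.log ((q : ℝ) ^ 2) / Real.log (Real.log ((q : ℝ) ^ 2)))) with hTdef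
  set ℓ := 1 + Real.log q with hℓ
  set Y := ⌊(q : ℝ) ^ ((1 + β) / 2)⌋₊ with hY
  set R := ⌊(q : ℝ) ^ β⌋₊ with hR
  have hlogq : 1 < Real.log q := by
    rw [Real.lt_log_iff_exp_lt hq0]; linarith [Real.exp_one_lt_three]
  have hYge : (q : ℝ) ^ ((1 + β) / 2) / 2 ≤ Y :=
    half_le_floor (Real.one_le_rpow hq1 (by linarith))
  have hRge : (q : ℝ) ^ β / 2 ≤ R := half_le_floor (Real.one_le_rpow hq1 hβ0.le)
  have hYq : Y ≤ q := by
    refine Nat.floor_le_of_le ?_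
    calc (q : ℝ) ^ ((1 + β) / 2) ≤ (q : ℝ) ^ (1 : ℝ) :=
          Real.rpow_le_rpow_of_exponent_le hq1 (by linarith)
      _ = q := Real.rpow_one _
  have hRY : R ≤ Y := Nat.floor_mono (Real.rpow_le_rpow_of_exponent_le hq1 (by linarith))
  have hYq' : (Y : ℝ) ≤ q := by exact_mod_cast hYq
  have hRY' : (R : ℝ) ≤ Y := by exact_mod_cast hRY
  have hY0 : (0 : ℝ) < Y := lt_of_lt_of_le (by positivity) hYge
  have hR0 : (0 : ℝ) < R := lt_of_lt_of_le (by positivity) hRge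
  have hLY : Real.log Y ≤ Real.log q := Real.log_le_log hY0 hYq'
  have hLY0 : 0 ≤ Real.log Y := Real.log_natCast_nonneg Y
  have hdiv : ∀ n, 0 < n → n < q * Y → (#n.divisors : ℝ) ≤ T := by
    intro n hn hnq
    refine card_divisors_le_exp hn.ne' ?_ ?_
    · have : n ≤ q * q := hnq.le.trans (Nat.mul_le_mul_left q hYq)
      rw [pow_two]; exact_mod_cast this
    · rw [Real.log_pow]; push_cast; linarith
  have hT1 : 1 ≤ T := by
    have := hdiv 1 one_pos (by
      have : 0 < Y := by exact_mod_cast hY0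
      have := le_of_max_le_right hq
      nlinarith)
    simpa using this
  have hmain := main_term_le a Y (hRY.trans hYq)
  have herr := error_sum_le ha Y R (by linarith) hdiv
  have hE := error_bound_simplify hR0.le hY0.le hRY' hYq' hT1 hLY0 hLY
  -- `52 = 2 · 26` makes the error at most half the main term; the two floors lose a factor `4`,
  -- whence `208 = 4 · 52`. The exponent `1 + 9ε` is `(1 + 3β)/2` at `β = 1/3 + 6ε`.
  have hprod : 52 * (q * (T * ℓ ^ 2)) ≤ R * Y := by
    have b1 : (q : ℝ) ^ (1 + 9 * ε) / 4 ≤ R * Y := by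
      calc (q : ℝ) ^ (1 + 9 * ε) / 4 ≤ (q : ℝ) ^ (β + (1 + β) / 2) / 4 := by
            have := Real.rpow_le_rpow_of_exponent_le hq1
              (show 1 + 9 * ε ≤ β + (1 + β) / 2 by linarith)
            linarith
        _ = (q : ℝ) ^ β / 2 * ((q : ℝ) ^ ((1 + β) / 2) / 2) := by
            rw [Real.rpow_add hq0]; ring
        _ ≤ _ := by gcongr
    have b2 : 208 * (T * ℓ ^ 2) ≤ (q : ℝ) ^ (9 * ε) := by
      calc 208 * (T * ℓ ^ 2) = T * (208 * ℓ ^ 2) := by ring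
        _ ≤ (q : ℝ) ^ ε * (q : ℝ) ^ ε := by gcongr
        _ = (q : ℝ) ^ (ε + ε) := (Real.rpow_add hq0 _ _).symm
        _ ≤ _ := Real.rpow_le_rpow_of_exponent_le hq1 (by linarith)
    rw [Real.rpow_add hq0, Real.rpow_one] at b1
    have := mul_le_mul_of_nonneg_left b2 hq0.le
    linarith
  set G : ℝ := (#(goodPairs a Y R) : ℝ) with hG
  have hfin : (Y : ℝ) ^ 2 * R ^ 2 ≤ 2 * (q * (R * G)) := by
    have : 26 * (R * Y) * (q * (T * ℓ ^ 2)) ≤ (Y : ℝ) ^ 2 * R ^ 2 / 2 := by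
      have := mul_le_mul_of_nonneg_left hprod (mul_pos hR0 hY0).le
      nlinarith
    linarith
  have hfin2 : (Y : ℝ) ^ 2 * R ≤ 2 * (q * G) := by
    refine le_of_mul_le_mul_right ?_ hR0
    linarith
  have hlow := expected_count_le hq0 hYge hRge
  have : q * ((q : ℝ) ^ (2 * β) / 16) ≤ q * G := by linarith
  exact le_of_mul_le_mul_left this hq0

/-- The integer attached to a pair. -/
def pairNorm (p : ℕ × ℕ) : ℕ := (p.1 + 1) ^ 2 + (p.2 + 1) ^ 2

theorem finite_twoSquaresApprox (α C γ N : ℝ) : (twoSquaresApprox α C γ N).Finite := by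
  refine (Set.finite_Iic ⌊N⌋₊).subset ?_
  rintro n ⟨_, hn, _⟩
  exact Nat.le_floor hn

theorem pairNorm_mem {α β : ℝ} {a : ℤ} {q : ℕ} (hadm : IsAdmissibleFraction α a q)
    (hβ0 : 0 < β) (hβ1 : β < 1) {p : ℕ × ℕ}
    (hp : p ∈ goodPairs (a : ZMod q) ⌊(q : ℝ) ^ ((1 + β) / 2)⌋₊ ⌊(q : ℝ) ^ β⌋₊) :
    pairNorm p ∈ twoSquaresApprox α 100 ((1 - β) / (1 + β)) (2 * (q : ℝ) ^ (1 + β)) := by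
  obtain ⟨hq, -, happ⟩ := hadm
  have hq0 : (0 : ℝ) < q := by exact_mod_cast (by omega : 0 < q)
  obtain ⟨hbox, r, hr, s, hs, hcong⟩ := mem_filter.1 hp
  rw [mem_product, mem_range, mem_range] at hbox
  rw [mem_range] at hr hs
  set n := pairNorm p with hn
  have hn0 : 0 < n := by rw [hn, pairNorm]; positivity
  have hsq : ((q : ℝ) ^ ((1 + β) / 2)) ^ 2 = (q : ℝ) ^ (1 + β) := by
    rw [← Real.rpow_natCast, ← Real.rpow_mul hq0.le]; congr 1; push_cast; ring
  have hle : ∀ x : ℕ, x < ⌊(q : ℝ) ^ ((1 + β) / 2)⌋₊ → ((x : ℝ) + 1) ^ 2 ≤ (q : ℝ) ^ (1 + β) := by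
    intro x hx
    rw [← hsq]
    have : ((x + 1 : ℕ) : ℝ) ≤ (q : ℝ) ^ ((1 + β) / 2) :=
      (Nat.cast_le.2 hx).trans (Nat.floor_le (by positivity))
    push_cast at this
    gcongr
  have hnX : (n : ℝ) ≤ 2 * (q : ℝ) ^ (1 + β) := by
    have h1 := hle _ hbox.1
    have h2 := hle _ hbox.2
    rw [hn, pairNorm]; push_cast; linarith
  refine ⟨hn0, hnX, ⟨p.1 + 1, p.2 + 1, by rw [hn, pairNorm]; push_cast; ring⟩, ?_⟩
  obtain ⟨k, hk⟩ : (q : ℤ) ∣ a * n + s - r := by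
    rw [← ZMod.intCast_zmod_eq_zero_iff_dvd]
    rw [← hcong, hn, pairNorm]; push_cast; ring
  have hk' : (a : ℝ) * n + s - r = q * k := by exact_mod_cast hk
  set δ := (q : ℝ) ^ (β - 1) with hδ
  have hδ0 : 0 < δ := by positivity
  have hdiff : |(r : ℝ) - s| ≤ (q : ℝ) ^ β := by
    have hr' : (r : ℝ) ≤ (q : ℝ) ^ β :=
      (Nat.cast_le.2 hr.le).trans (Nat.floor_le (by positivity))
    have hs' : (s : ℝ) ≤ (q : ℝ) ^ β :=
      (Nat.cast_le.2 hs.le).trans (Nat.floor_le (by positivity))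
    rw [abs_le]
    constructor <;> linarith [(Nat.cast_nonneg r : (0:ℝ) ≤ r), (Nat.cast_nonneg s : (0:ℝ) ≤ s)]
  -- `48 δ` comes from replacing `α` by `a / q`, and `δ` from `|r - s| / q`.
  have hdist : distNearestInt ((n : ℝ) * α) ≤ 49 * δ := by
    refine (round_le _ k).trans ?_
    have e1 : (n : ℝ) * α - k = n * (α - a / q) + (r - s) / q := by
      have : (k : ℝ) = (a * n + s - r) / q := by rw [hk']; field_simp
      rw [this]; field_simp; ring
    rw [e1]
    refine (abs_add_le _ _).trans ?_
    rw [abs_mul, abs_div, Nat.abs_cast, Nat.abs_cast]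
    have e2 : (n : ℝ) * |α - a / q| ≤ 2 * (q : ℝ) ^ (1 + β) * (24 / (q : ℝ) ^ 2) := by
      gcongr
    have e3 : (q : ℝ) ^ (1 + β) = δ * (q : ℝ) ^ 2 := by
      rw [hδ, ← Real.rpow_natCast, ← Real.rpow_add hq0]; congr 1; push_cast; ring
    have e4 : (q : ℝ) ^ β = δ * q := by
      rw [hδ, ← Real.rpow_add_one hq0.ne']; congr 1; ring
    have e5 : |(r : ℝ) - s| / q ≤ δ := by
      rw [div_le_iff₀ hq0, ← e4]; exact hdiff
    have e6 : 2 * (q : ℝ) ^ (1 + β) * (24 / (q : ℝ) ^ 2) = 48 * δ := by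
      rw [e3]; field_simp; ring
    linarith
  refine hdist.trans_lt ?_
  set γ := (1 - β) / (1 + β) with hγ
  have hγ0 : 0 < γ := div_pos (by linarith) (by linarith)
  have hγ1 : γ ≤ 1 := by rw [hγ, div_le_one (by linarith)]; linarith
  -- As `δ = X^(-γ)` and `2^(-γ) ≥ 1/2`, `100 n^(-γ) ≥ 50 δ > 49 δ`.
  have f1 : (2 * (q : ℝ) ^ (1 + β)) ^ (-γ) ≤ (n : ℝ) ^ (-γ) :=
    Real.rpow_le_rpow_of_nonpos (by exact_mod_cast hn0) hnX (by linarith)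
  have f2 : ((q : ℝ) ^ (1 + β)) ^ (-γ) = δ := by
    rw [← Real.rpow_mul hq0.le, hδ]; congr 1
    rw [hγ]; have : 1 + β ≠ 0 := by linarith
    field_simp; ring
  have f3 : (1 / 2 : ℝ) ≤ (2 : ℝ) ^ (-γ) := by
    calc (1 / 2 : ℝ) = (2 : ℝ) ^ (-1 : ℝ) := by rw [Real.rpow_neg_one]; norm_num
      _ ≤ _ := Real.rpow_le_rpow_of_exponent_le (by norm_num) (by linarith)
  rw [Real.mul_rpow (by norm_num) (by positivity), f2] at f1
  nlinarith

/-- Each fibre of `pairNorm` has at most `τ(n)² ≤ T²` elements. -/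
theorem card_le_ncard_mul {A : Set ℕ} (hA : A.Finite) (s : Finset (ℕ × ℕ))
    (hs : ∀ p ∈ s, pairNorm p ∈ A) {T : ℝ} (hT : ∀ n ∈ A, 0 < n → (#n.divisors : ℝ) ≤ T) :
    (#s : ℝ) ≤ T ^ 2 * A.ncard := by
  rw [Set.ncard_eq_toFinset_card A hA, card_eq_sum_card_fiberwise (f := pairNorm) (t := hA.toFinset)
    (fun p hp => by simpa using hs p hp)]
  push_cast
  rw [mul_comm, ← nsmul_eq_mul]
  refine sum_le_card_nsmul _ _ _ fun n hn => ?_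
  rw [Set.Finite.mem_toFinset] at hn
  rcases Nat.eq_zero_or_pos n with rfl | hn0
  · rw [filter_eq_empty_iff.2 fun p _ h => by simp [pairNorm] at h]
    simp; positivity
  have hinj : Function.Injective fun p : ℕ × ℕ => (p.1 + 1, p.2 + 1) := by
    intro p r h
    simpa [Prod.ext_iff] using h
  have h1 := card_repr_le hn0 ({p ∈ s | pairNorm p = n}.image fun p => (p.1 + 1, p.2 + 1)) (by
    intro r hr
    obtain ⟨p, hp, rfl⟩ := mem_image.1 hr
    exact ⟨Nat.succ_pos _, Nat.succ_pos _, (mem_filter.1 hp).2⟩)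
  rw [card_image_of_injective _ hinj] at h1
  have h2 := hT n hn hn0
  calc (#{p ∈ s | pairNorm p = n} : ℝ) ≤ (#n.divisors : ℝ) * #n.divisors := by exact_mod_cast h1
    _ ≤ T * T := mul_le_mul h2 h2 (by positivity) ((Nat.cast_nonneg _).trans h2)
    _ = T ^ 2 := by ring

theorem one_mem_twoSquaresApprox (α γ : ℝ) {N : ℝ} (hN : 1 ≤ N) :
    1 ∈ twoSquaresApprox α 100 γ N := by
  refine ⟨one_pos, by simpa using hN, ⟨1, 0, by norm_num⟩, ?_⟩
  have := abs_sub_round (α)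
  simp only [distNearestInt, Nat.cast_one, one_mul, Real.one_rpow]
  linarith

end Counting

/-! ### The lower bounds. -/

section LowerBounds

open Finset Filter Topology

theorem exists_lower_bound {ε : ℝ} (hε : 0 < ε) : ∃ c : ℝ, 0 < c ∧
    ∀ α : ℝ, ∀ (a : ℤ) (q : ℕ), IsAdmissibleFraction α a q →
      ∀ β : ℝ, 1 / 3 + 6 * ε < β → β < 1 →
      ∀ X γ : ℝ, X = (q : ℝ) ^ (1 + β) → γ = (1 - β) / (1 + β) →
        c * X ^ (1 - γ - 96 / Real.log (Real.log X)) ≤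
          ((twoSquaresApprox α 100 γ (2 * X)).ncard : ℝ) := by
  obtain ⟨Q, hQ⟩ := exists_forall_le_card_goodPairs hε
  -- `1/16` serves `q ≥ Q`. For `q < Q` the element `n = 1` suffices, because `X ≤ q² ≤ (Q + 1)²`.
  refine ⟨min (1 / 16) (1 / ((Q : ℝ) + 1) ^ 2), by positivity, ?_⟩
  intro α a q hadm β hβ hβ1 X γ hX hγ
  have hq2 : q ≠ 2 := by
    rintro rfl
    have h := hadm.2.1
    simp at h
  have hq3 : 3 ≤ q := by have := hadm.1; omega
  have hq3' : (3 : ℝ) ≤ q := by exact_mod_cast hq3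
  have hq0 : (0 : ℝ) < q := by linarith
  have hX0 : 0 < X := by rw [hX]; positivity
  have hlogq : 1 < Real.log q := by
    rw [Real.lt_log_iff_exp_lt hq0]; linarith [Real.exp_one_lt_three]
  have hlogX : 1 < Real.log X := by
    rw [hX, Real.log_rpow hq0]; nlinarith
  have hllX : 0 < Real.log (Real.log X) := Real.log_pos hlogX
  have hX1 : 1 ≤ X := by
    rw [hX]; exact Real.one_le_rpow (by linarith) (by linarith)
  have hX2 : 2 ≤ X := by
    have h1 := Real.add_one_le_exp (Real.log X)
    rw [Real.exp_log hX0] at h1; linarith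
  have hγ0 : 0 < γ := by rw [hγ]; exact div_pos (by linarith) (by linarith)
  have hfin := finite_twoSquaresApprox α 100 γ (2 * X)
  rcases lt_or_ge q Q with hqQ | hqQ
  · have h1 : (1 : ℝ) ≤ (twoSquaresApprox α 100 γ (2 * X)).ncard := by
      have := (Set.ncard_pos hfin).2 ⟨1, one_mem_twoSquaresApprox α γ (by linarith)⟩
      exact_mod_cast this
    refine le_trans ?_ h1
    have hexp : X ^ (1 - γ - 96 / Real.log (Real.log X)) ≤ ((Q : ℝ) + 1) ^ 2 := by
      calc X ^ (1 - γ - 96 / Real.log (Real.log X)) ≤ X ^ (1 : ℝ) := by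
            refine Real.rpow_le_rpow_of_exponent_le hX1 ?_
            have : 0 < 96 / Real.log (Real.log X) := by positivity
            linarith
        _ = (q : ℝ) ^ (1 + β) := by rw [Real.rpow_one, hX]
        _ ≤ (q : ℝ) ^ (2 : ℝ) :=
            Real.rpow_le_rpow_of_exponent_le (by linarith) (by linarith)
        _ = (q : ℝ) ^ 2 := Real.rpow_two _
        _ ≤ _ := by
            have : (q : ℝ) ≤ Q := by exact_mod_cast hqQ.le
            gcongr; linarith
    calc _ ≤ 1 / ((Q : ℝ) + 1) ^ 2 * ((Q : ℝ) + 1) ^ 2 := by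
          gcongr; exact min_le_right _ _
      _ = 1 := by field_simp
  · have : NeZero q := ⟨by omega⟩
    have hunit : IsUnit (2 * (a : ZMod q)) := by
      have h := (ZMod.coe_int_isUnit_iff_isCoprime (2 * a) q).2
        (Int.isCoprime_iff_gcd_eq_one.2 hadm.2.1).symm
      exact_mod_cast h
    have hcard := hQ q hqQ (a : ZMod q) hunit β hβ hβ1
    set T := Real.exp (24 * (Real.log (2 * X) / Real.log (Real.log (2 * X)))) with hT
    have hlog2X : Real.log X ≤ Real.log (2 * X) := Real.log_le_log hX0 (by linarith)
    have hle := card_le_ncard_mul hfin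
      (goodPairs (a : ZMod q) ⌊(q : ℝ) ^ ((1 + β) / 2)⌋₊ ⌊(q : ℝ) ^ β⌋₊)
      (fun p hp => by rw [hX, hγ]; exact pairNorm_mem hadm (by linarith) hβ1 hp)
      (T := T) (fun n hn hn0 => card_divisors_le_exp hn0.ne' hn.2.1 (by linarith))
    set D := Real.log (Real.log X) with hD
    -- `96 = 2 · 24 · 2`: the square, the divisor bound, and `log (2X) ≤ 2 log X`.
    have hTX : T ^ 2 ≤ X ^ (96 / D) := by
      rw [hT, ← Real.exp_nat_mul, Real.rpow_def_of_pos hX0]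
      refine Real.exp_le_exp.2 ?_
      have h1 : Real.log (2 * X) ≤ 2 * Real.log X := by
        rw [← Nat.cast_two, ← Real.log_pow]
        refine Real.log_le_log (by positivity) ?_
        push_cast; nlinarith
      have h2 : D ≤ Real.log (Real.log (2 * X)) := Real.log_le_log (by linarith) hlog2X
      calc ((2 : ℕ) : ℝ) * (24 * (Real.log (2 * X) / Real.log (Real.log (2 * X))))
          ≤ ((2 : ℕ) : ℝ) * (24 * (2 * Real.log X / D)) := by gcongr
        _ = Real.log X * (96 / D) := by push_cast; ring
    have hmain : X ^ (1 - γ) = (q : ℝ) ^ (2 * β) := by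
      rw [hX, ← Real.rpow_mul hq0.le]
      congr 1
      rw [hγ]
      have : 1 + β ≠ 0 := by linarith
      field_simp; ring
    have hpow : 0 < X ^ (96 / D) := by positivity
    rw [Real.rpow_sub hX0, hmain, ← mul_div_assoc, div_le_iff₀ hpow]
    calc min (1 / 16) (1 / ((Q : ℝ) + 1) ^ 2) * (q : ℝ) ^ (2 * β)
        ≤ 1 / 16 * (q : ℝ) ^ (2 * β) := by gcongr; exact min_le_left _ _
      _ = (q : ℝ) ^ (2 * β) / 16 := by ring
      _ ≤ _ := hcard
      _ ≤ _ := hle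
      _ ≤ X ^ (96 / D) * _ := by gcongr
      _ = _ := mul_comm _ _

theorem frequently_lower_bound {α : ℝ} (hα : Irrational α) {ε : ℝ} (hε0 : 0 < ε) (hε1 : ε < 1 / 2)
    {δ : ℝ} (hδ0 : 0 < δ) (hδ1 : δ ≤ 1 / 4) : ∃ᶠ N : ℕ in atTop,
      (N : ℝ) ^ (1 / 2 + ε - δ) ≤ ((twoSquaresApprox α 1 (1 / 2 - ε) (N : ℝ)).ncard : ℝ) := by
  -- The slack `η` absorbs the constant, as `n^η ≥ 100` for `n > K`, and keeps `γ < 1/2`, which is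
  -- equivalent to `β > 1/3`.
  set η := min (ε / 2) (δ / 4) with hη
  have hη0 : 0 < η := by positivity
  have hηε : η ≤ ε / 2 := min_le_left _ _
  have hηδ : η ≤ δ / 4 := min_le_right _ _
  set γ := 1 / 2 - ε + η with hγ
  have hγ0 : 0 < γ := by linarith
  have hγ1 : γ < 1 / 2 := by linarith
  set β := (1 - γ) / (1 + γ) with hβ
  have hβ1 : β < 1 := by rw [hβ, div_lt_one (by linarith)]; linarith
  have hβ3 : 1 / 3 < β := by rw [hβ, div_lt_div_iff₀ (by norm_num) (by linarith)]; linarith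
  have hγβ : γ = (1 - β) / (1 + β) := by
    have : 1 + γ ≠ 0 := by linarith
    rw [hβ]; field_simp; ring
  -- With this `ε`, `1/3 + 6ε` is the midpoint of `1/3` and `β`.
  obtain ⟨c, hc, hlow⟩ := exists_lower_bound (ε := (β - 1 / 3) / 12) (by linarith)
  obtain ⟨K, hK⟩ := exists_nat_ge ((100 : ℝ) ^ (1 / η))
  set s := 1 / 2 + ε - δ with hs
  have hs0 : 0 < s := by linarith
  have hlarge : ∀ᶠ X : ℝ in atTop, 2 * X ^ s + K ≤ c * X ^ (s + δ / 2) ∧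
      96 / Real.log (Real.log X) ≤ δ / 4 ∧ 1 ≤ X := by
    have h1 : Tendsto (fun X : ℝ => Real.log (Real.log X)) atTop atTop :=
      Real.tendsto_log_atTop.comp Real.tendsto_log_atTop
    have h2 : Tendsto (fun X : ℝ => c * X ^ (δ / 2)) atTop atTop :=
      (tendsto_rpow_atTop (by positivity)).const_mul_atTop hc
    filter_upwards [h1.eventually_ge_atTop (96 / (δ / 4)), h2.eventually_ge_atTop (2 + K),
      eventually_ge_atTop 1] with X hX1 hX2 hX3
    have hX0 : 0 < X := by linarith
    refine ⟨?_, ?_, hX3⟩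
    · have h3 : 1 ≤ X ^ s := Real.one_le_rpow hX3 hs0.le
      have hK0 : (0 : ℝ) ≤ K := by positivity
      rw [Real.rpow_add hX0]
      calc 2 * X ^ s + K ≤ X ^ s * (2 + K) := by nlinarith
        _ ≤ X ^ s * (c * X ^ (δ / 2)) := by gcongr
        _ = _ := by ring
    · have hpos : 0 < Real.log (Real.log X) := lt_of_lt_of_le (by positivity) hX1
      rw [div_le_iff₀ (by positivity)] at hX1
      rw [div_le_iff₀ hpos]; linarith
  obtain ⟨B, hB⟩ := eventually_atTop.1 hlarge
  rw [frequently_atTop]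
  intro M
  obtain ⟨Q, hQ⟩ := exists_nat_ge (max B M)
  obtain ⟨a, q, hqQ, hadm⟩ := exists_admissible_gt hα Q
  set X := (q : ℝ) ^ (1 + β) with hX
  have hq1 : (1 : ℝ) ≤ q := by exact_mod_cast hadm.1.le
  have hqX : (q : ℝ) ≤ X := by
    calc (q : ℝ) = (q : ℝ) ^ (1 : ℝ) := (Real.rpow_one _).symm
      _ ≤ _ := Real.rpow_le_rpow_of_exponent_le hq1 (by linarith)
  have hQq : (Q : ℝ) ≤ q := by exact_mod_cast hqQ.le
  have hBX : B ≤ X := (le_max_left _ _).trans (hQ.trans (hQq.trans hqX))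
  have hMX : (M : ℝ) ≤ X := (le_max_right _ _).trans (hQ.trans (hQq.trans hqX))
  obtain ⟨hX1, hX2, hX3⟩ := hB X hBX
  have hX0 : 0 < X := by linarith
  refine ⟨⌊2 * X⌋₊, Nat.le_floor (by linarith), ?_⟩
  have hcount := hlow α a q hadm β (by linarith) hβ1 X γ hX hγβ
  have hsub : twoSquaresApprox α 100 γ (2 * X) ⊆
      twoSquaresApprox α 1 (1 / 2 - ε) (⌊2 * X⌋₊ : ℝ) ∪ (Ico 1 (K + 1) : Finset ℕ) := by
    rintro n ⟨hn0, hnX, hsq, hdist⟩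
    by_cases hnK : n ≤ K
    · right; simp; omega
    · left
      refine ⟨hn0, by exact_mod_cast Nat.le_floor hnX, hsq, hdist.trans_le ?_⟩
      have hn0' : (0 : ℝ) < n := by exact_mod_cast hn0
      have h100 : (100 : ℝ) ≤ (n : ℝ) ^ η := by
        have h1 : (100 : ℝ) ^ (1 / η) ≤ n := hK.trans (by exact_mod_cast (by omega : K ≤ n))
        calc (100 : ℝ) = ((100 : ℝ) ^ (1 / η)) ^ η := by
              rw [← Real.rpow_mul (by norm_num), one_div_mul_cancel hη0.ne', Real.rpow_one]
          _ ≤ _ := Real.rpow_le_rpow (by positivity) h1 hη0.le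
      calc 100 * (n : ℝ) ^ (-γ) ≤ (n : ℝ) ^ η * (n : ℝ) ^ (-γ) := by gcongr
        _ = 1 * (n : ℝ) ^ (-(1 / 2 - ε)) := by
            rw [← Real.rpow_add hn0', one_mul, hγ]; congr 1; ring
  have hcard : ((twoSquaresApprox α 100 γ (2 * X)).ncard : ℝ) ≤
      (twoSquaresApprox α 1 (1 / 2 - ε) (⌊2 * X⌋₊ : ℝ)).ncard + K := by
    have h1 := Set.ncard_le_ncard hsub
      ((finite_twoSquaresApprox _ _ _ _).union (finite_toSet _))
    have h2 := h1.trans (Set.ncard_union_le _ _)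
    rw [Set.ncard_coe_finset, Nat.card_Ico, Nat.add_sub_cancel] at h2
    exact_mod_cast h2
  have hN : (⌊2 * X⌋₊ : ℝ) ^ s ≤ 2 * X ^ s := by
    calc (⌊2 * X⌋₊ : ℝ) ^ s ≤ (2 * X) ^ s :=
          Real.rpow_le_rpow (by positivity) (Nat.floor_le (by positivity)) hs0.le
      _ = 2 ^ s * X ^ s := Real.mul_rpow (by norm_num) hX0.le
      _ ≤ 2 ^ (1 : ℝ) * X ^ s := by
          have := Real.rpow_le_rpow_of_exponent_le one_le_two (show s ≤ 1 by linarith)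
          gcongr
      _ = _ := by rw [Real.rpow_one]
  -- Of the allowance `δ`, `η` and the `log log` term use at most `δ/4` each; the remaining `δ/2`
  -- beats `c`, the floor and the `K` discarded integers.
  have hexp : c * X ^ (s + δ / 2) ≤ c * X ^ (1 - γ - 96 / Real.log (Real.log X)) := by
    have := Real.rpow_le_rpow_of_exponent_le hX3
      (show s + δ / 2 ≤ 1 - γ - 96 / Real.log (Real.log X) by linarith)
    gcongr
  linarith

end LowerBounds

theorem corollary1 :
    -- the lower bound: `C₁`, `C₂` are absolute, the implied constant `c` depends only on `ε`
    (∃ C₁ : ℝ, 0 < C₁ ∧ ∃ C₂ : ℝ, 0 < C₂ ∧ ∀ ε : ℝ, 0 < ε → ∃ c : ℝ, 0 < c ∧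
      ∀ α : ℝ, Irrational α → ∀ (a : ℤ) (q : ℕ), IsAdmissibleFraction α a q →
      ∀ β : ℝ, 1 / 3 + 6 * ε < β → β < 1 →
      ∀ X γ : ℝ, X = (q : ℝ) ^ (1 + β) → γ = (1 - β) / (1 + β) →
        c * X ^ (1 - γ - C₂ / Real.log (Real.log X)) ≤
          ((twoSquaresApprox α C₁ γ (2 * X)).ncard : ℝ)) ∧
    -- infinitely many admissible fractions
    (∀ α : ℝ, Irrational α →
      {r : ℚ | ∃ (a : ℤ) (q : ℕ), IsAdmissibleFraction α a q ∧ r = (a : ℚ) / (q : ℚ)}.Infinite) ∧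
    -- the exponent `1 / 2 - ε`, quantitatively
    (∀ α : ℝ, Irrational α → ∀ ε : ℝ, 0 < ε → ε < 1 / 2 → ∀ δ : ℝ, 0 < δ →
      ∃ᶠ N : ℕ in Filter.atTop,
        (N : ℝ) ^ (1 / 2 + ε - δ) ≤
          ((twoSquaresApprox α 1 (1 / 2 - ε) (N : ℝ)).ncard : ℝ)) := by
  refine ⟨⟨100, by norm_num, 96, by norm_num, fun ε hε => ?_⟩,
    fun α hα => infinite_admissible hα, fun α hα ε hε0 hε1 δ hδ => ?_⟩
  · obtain ⟨c, hc, h⟩ := exists_lower_bound hε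
    exact ⟨c, hc, fun α _ => h α⟩
  -- Shrinking `δ` to at most `1/4` only strengthens the bound, as `N ≥ 1`.
  · refine ((frequently_lower_bound hα hε0 hε1 (lt_min hδ (by norm_num : (0 : ℝ) < 1 / 4))
      (min_le_right _ _)).and_eventually (Filter.eventually_ge_atTop 1)).mono fun N hN => ?_
    refine le_trans (Real.rpow_le_rpow_of_exponent_le (by exact_mod_cast hN.2) ?_) hN.1
    linarith [min_le_left δ (1 / 4 : ℝ)]
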